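/- For a bounded open set $\Omega\subset\mathbb R^2$ let $H_0^1(\Omega)$ be the closure of $C_c^\infty(\Omega)$ in $H^1(\Omega)$ (real-valued functions), with the norm $\|u\|_{H_0^1(\Omega)}=\|\nabla u\|_{L^2(\Omega)}$, and let $C_P(\Omega)$ be the Poincaré constant of $\Omega$, that is, the least $k\ge 0$ such that $\|u\|_{L^2(\Omega)}\le k\,\|\nabla u\|_{L^2(\Omega)}$ for all $u\in H_0^1(\Omega)$. For $W\in L^\infty(\Omega;\mathbb R^2)$ and $f\in L^\infty(\Omega;\mathbb R)$, a solution $\Phi\in H_0^1(\Omega)$ of $-\Delta\Phi+W\cdot\nabla\Phi=f$ in $\Omega$ is a $\Phi\in H_0^1(\Omega)$ with $$\int_\Omega\nabla\Phi\cdot\nabla v+\int_\Omega (W\cdot\nabla\Phi)\,v=\int_\Omega f v\qquad\text{for all } v\in H_0^1(\Omega).$$ **Lemma (maximum principle with an $L^\infty$ source).** For every $C'\ge 1$ there exist constants $c>0$ and $C>0$, depending only on $C'$, such that for every $\varepsilon>0$, every bounded open set $\Omega\subset\mathbb R^2$ with $C_P(\Omega)\le C'\varepsilon$, every $W\in L^\infty(\Omega;\mathbb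 R^2)$ and every $f\in L^\infty(\Omega;\mathbb R)$ with $$\varepsilon+\varepsilon\|W\|_{L^\infty(\Omega)}\le c,$$ the equation $-\Delta\Phi+W\cdot\nabla\Phi=f$ in $\Omega$ has a unique solution $\Phi\in H_0^1(\Omega)$, and this solution satisfies $$\|\Phi\|_{L^\infty(\Omega)}\le C\varepsilon^2\|f\|_{L^\infty(\Omega)}\qquad\text{and}\qquad \|\Phi\|_{H_0^1(\Omega)}\le C\varepsilon\,\|f\|_{L^2(\Omega)}.$$ -/

import Mathlib

open MeasureTheory Filter Topology
open scoped ENNReal ContDiff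

noncomputable section

namespace Landis

/-- The Euclidean plane `ℝ²`. -/
abbrev Plane : Type := EuclideanSpace ℝ (Fin 2)

/-- Lebesgue measure on `Ω`. -/
abbrev vol (Ω : Set Plane) : Measure Plane := volume.restrict Ω

/-- The Hilbert space `L²(Ω) × L²(Ω; ℝ²)` with `‖(u, G)‖² = ‖u‖² + ‖G‖²`. The space `H¹(Ω)` sits
isometrically in it through `u ↦ (u, ∇u)`. -/
abbrev L2Pair (Ω : Set Plane) : Type :=
  WithLp 2 (Lp ℝ 2 (vol Ω) × Lp Plane 2 (vol Ω))

/-- `φ ∈ C_c^∞(Ω)`. -/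
structure IsTest (Ω : Set Plane) (φ : Plane → ℝ) : Prop where
  contDiff : ContDiff ℝ ∞ φ
  compact : HasCompactSupport φ
  subset : tsupport φ ⊆ Ω

/-- `G` is the weak gradient of `u` in `Ω`. -/
def HasWeakGradient (Ω : Set Plane) (u : Plane → ℝ) (G : Plane → Plane) : Prop :=
  ∀ φ : Plane → ℝ, IsTest Ω φ → ∀ e : Plane,
    ∫ x in Ω, fderiv ℝ φ x e * u x = -∫ x in Ω, φ x * inner ℝ e (G x)

theorem IsTest.zero (Ω : Set Plane) : IsTest Ω (fun _ => (0 : ℝ)) :=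
  ⟨contDiff_const, HasCompactSupport.zero, by
    have h : tsupport (fun _ : Plane => (0 : ℝ)) = ∅ := by
      rw [tsupport_eq_empty_iff]; rfl
    rw [h]; exact Set.empty_subset _⟩

theorem IsTest.add {Ω : Set Plane} {φ ψ : Plane → ℝ} (hφ : IsTest Ω φ) (hψ : IsTest Ω ψ) :
    IsTest Ω (φ + ψ) :=
  ⟨hφ.contDiff.add hψ.contDiff, hφ.compact.add hψ.compact,
    (tsupport_add φ ψ).trans (Set.union_subset hφ.subset hψ.subset)⟩

theorem IsTest.smul {Ω : Set Plane} {φ : Plane → ℝ} (c : ℝ) (hφ : IsTest Ω φ) :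
    IsTest Ω (c • φ) :=
  ⟨contDiff_const.smul hφ.contDiff, hφ.compact.smul_left (f := fun _ => c),
    (tsupport_smul_subset_right (fun _ => c) φ).trans hφ.subset⟩

theorem IsTest.differentiable {Ω : Set Plane} {φ : Plane → ℝ} (hφ : IsTest Ω φ) :
    Differentiable ℝ φ :=
  hφ.contDiff.differentiable (by simp)

/-- The pairs `(φ, ∇φ)` with `φ ∈ C_c^∞(Ω)`. -/
def testPairs (Ω : Set Plane) : Submodule ℝ (L2Pair Ω) where
  carrier := {p | ∃ φ : Plane → ℝ, IsTest Ω φ ∧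
    (p.fst : Plane → ℝ) =ᵐ[vol Ω] φ ∧ (p.snd : Plane → Plane) =ᵐ[vol Ω] gradient φ}
  zero_mem' := by
    refine ⟨fun _ => 0, IsTest.zero Ω, ?_, ?_⟩
    · exact Lp.coeFn_zero ℝ 2 (vol Ω)
    · filter_upwards [Lp.coeFn_zero Plane 2 (vol Ω)] with x hx
      simpa [gradient] using hx
  add_mem' := by
    rintro p q ⟨φ, hφ, hp1, hp2⟩ ⟨ψ, hψ, hq1, hq2⟩
    refine ⟨φ + ψ, hφ.add hψ, ?_, ?_⟩
    · rw [WithLp.add_fst]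
      filter_upwards [Lp.coeFn_add p.fst q.fst, hp1, hq1] with x h h1 h2
      rw [h, Pi.add_apply, Pi.add_apply, h1, h2]
    · rw [WithLp.add_snd]
      filter_upwards [Lp.coeFn_add p.snd q.snd, hp2, hq2] with x h h1 h2
      rw [h, Pi.add_apply, h1, h2]
      simp only [gradient]
      rw [fderiv_add (hφ.differentiable x) (hψ.differentiable x), map_add]
  smul_mem' := by
    rintro c p ⟨φ, hφ, hp1, hp2⟩
    refine ⟨c • φ, hφ.smul c, ?_, ?_⟩
    · rw [WithLp.smul_fst]
      filter_upwards [Lp.coeFn_smul c p.fst, hp1] with x h h1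
      rw [h, Pi.smul_apply, Pi.smul_apply, h1]
    · rw [WithLp.smul_snd]
      filter_upwards [Lp.coeFn_smul c p.snd, hp2] with x h h1
      rw [h, Pi.smul_apply, h1]
      simp only [gradient]
      rw [fderiv_const_smul (hφ.differentiable x), map_smul]

/-- `H₀¹(Ω)`, the closure of `C_c^∞(Ω)` for the norm of `H¹(Ω)`, realised as the space of pairs
`(u, ∇u)`; `hasWeakGradient_of_mem_H10` says that the second entry is the weak gradient of the
first. -/
def H10 (Ω : Set Plane) : Submodule ℝ (L2Pair Ω) :=
  (testPairs Ω).topologicalClosure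

/-- The function `u` of an element of `L2Pair Ω`. -/
abbrev L2Pair.fn {Ω : Set Plane} (p : L2Pair Ω) : Lp ℝ 2 (vol Ω) := WithLp.fst p

/-- The gradient of an element of `L2Pair Ω`. -/
abbrev L2Pair.grad {Ω : Set Plane} (p : L2Pair Ω) : Lp Plane 2 (vol Ω) := WithLp.snd p

theorem IsTest.memLp {Ω : Set Plane} {φ : Plane → ℝ} (hφ : IsTest Ω φ) :
    MemLp φ 2 (vol Ω) :=
  (hφ.contDiff.continuous.memLp_of_hasCompactSupport hφ.compact).restrict Ω

theorem IsTest.memLp_fderiv {Ω : Set Plane} {φ : Plane → ℝ} (hφ : IsTest Ω φ) (e : Plane) :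
    MemLp (fun x => fderiv ℝ φ x e) 2 (vol Ω) :=
  Continuous.memLp_of_hasCompactSupport
    ((hφ.contDiff.continuous_fderiv (by simp)).clm_apply continuous_const)
    (hφ.compact.fderiv_apply (𝕜 := ℝ) e)

theorem IsTest.memLp_smul {Ω : Set Plane} {φ : Plane → ℝ} (hφ : IsTest Ω φ) (e : Plane) :
    MemLp (fun x => φ x • e) 2 (vol Ω) :=
  Continuous.memLp_of_hasCompactSupport (hφ.contDiff.continuous.smul continuous_const)
    (hφ.compact.smul_right (f' := fun _ => e))

theorem testPairs_hasWeakGradient {Ω : Set Plane} {p : L2Pair Ω} (hp : p ∈ testPairs Ω) :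
    HasWeakGradient Ω p.fn p.grad := by
  obtain ⟨ψ, hψ, h1, h2⟩ := hp
  intro φ hφ e
  have cφ := hφ.contDiff.continuous
  have cψ := hψ.contDiff.continuous
  have dφ : Continuous fun x => fderiv ℝ φ x e :=
    (hφ.contDiff.continuous_fderiv (by simp)).clm_apply continuous_const
  have dψ : Continuous fun x => fderiv ℝ ψ x e :=
    (hψ.contDiff.continuous_fderiv (by simp)).clm_apply continuous_const
  have key := integral_mul_fderiv_eq_neg_fderiv_mul_of_integrable (μ := (volume : Measure Plane))
    (f := ψ) (g := φ) (v := e)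
    ((dψ.mul cφ).integrable_of_hasCompactSupport hφ.compact.mul_left)
    ((cψ.mul dφ).integrable_of_hasCompactSupport hψ.compact.mul_right)
    ((cψ.mul cφ).integrable_of_hasCompactSupport hψ.compact.mul_right)
    (fun x _ => hψ.differentiable x) (fun x _ => hφ.differentiable x)
  have e1 : ∫ x in Ω, fderiv ℝ φ x e * p.fn x = ∫ x, ψ x * fderiv ℝ φ x e := by
    rw [← setIntegral_eq_integral_of_forall_compl_eq_zero (s := Ω)
      (f := fun x => ψ x * fderiv ℝ φ x e)]
    · refine integral_congr_ae ?_
      filter_upwards [h1] with x hx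
      rw [hx, mul_comm]
    · intro x hx
      rw [image_eq_zero_of_notMem_tsupport (fun h => hx (hψ.subset h)), zero_mul]
  have e2 : ∫ x in Ω, φ x * inner ℝ e (p.grad x) = ∫ x, fderiv ℝ ψ x e * φ x := by
    rw [← setIntegral_eq_integral_of_forall_compl_eq_zero (s := Ω)
      (f := fun x => fderiv ℝ ψ x e * φ x)]
    · refine integral_congr_ae ?_
      filter_upwards [h2] with x hx
      rw [hx, real_inner_comm, gradient, InnerProductSpace.toDual_symm_apply, mul_comm]
    · intro x hx
      rw [image_eq_zero_of_notMem_tsupport (fun h => hx (hφ.subset h)), mul_zero]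
  rw [e1, e2, key]

theorem hasWeakGradient_of_mem_H10 {Ω : Set Plane} {p : L2Pair Ω} (hp : p ∈ H10 Ω) :
    HasWeakGradient Ω p.fn p.grad := by
  intro φ hφ e
  have a1 : ∀ q : L2Pair Ω, ∫ x in Ω, fderiv ℝ φ x e * q.fn x =
      inner ℝ ((hφ.memLp_fderiv e).toLp _) q.fn := by
    intro q
    rw [L2.inner_def]
    refine integral_congr_ae ?_
    filter_upwards [(hφ.memLp_fderiv e).coeFn_toLp] with x hx
    rw [hx]
    simp [mul_comm]
  have a2 : ∀ q : L2Pair Ω, ∫ x in Ω, φ x * inner ℝ e (q.grad x) =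
      inner ℝ ((hφ.memLp_smul e).toLp _) q.grad := by
    intro q
    rw [L2.inner_def]
    refine integral_congr_ae ?_
    filter_upwards [(hφ.memLp_smul e).coeFn_toLp] with x hx
    rw [hx, real_inner_smul_left]
  have hcl : IsClosed {q : L2Pair Ω | ∫ x in Ω, fderiv ℝ φ x e * q.fn x =
      -∫ x in Ω, φ x * inner ℝ e (q.grad x)} := by
    simp only [a1, a2]
    refine isClosed_eq ?_ ?_
    · exact continuous_const.inner (WithLp.prod_continuous_ofLp 2 _ _).fst
    · exact (continuous_const.inner (WithLp.prod_continuous_ofLp 2 _ _).snd).neg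
  have hsub : (testPairs Ω : Set (L2Pair Ω)) ⊆ {q : L2Pair Ω |
      ∫ x in Ω, fderiv ℝ φ x e * q.fn x = -∫ x in Ω, φ x * inner ℝ e (q.grad x)} :=
    fun q hq => testPairs_hasWeakGradient hq φ hφ e
  exact closure_minimal hsub hcl hp

/-- The Poincaré constant `C_P(Ω)`: the least `k ∈ [0, ∞]` such that
`‖u‖_{L²(Ω)} ≤ k ‖∇u‖_{L²(Ω)}` for all `u ∈ H₀¹(Ω)` (`∞` if there is none). -/
def poincareConst (Ω : Set Plane) : ℝ≥0∞ :=
  sInf {k : ℝ≥0∞ | ∀ u ∈ H10 Ω, ‖u.fn‖ₑ ≤ k * ‖u.grad‖ₑ}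

/-- `Φ ∈ H₀¹(Ω)` is a weak solution of `-ΔΦ + W · ∇Φ = f` in `Ω`. -/
def IsWeakSolution (Ω : Set Plane) (W : Plane → Plane) (f : Plane → ℝ) (Φ : L2Pair Ω) : Prop :=
  Φ ∈ H10 Ω ∧ ∀ v ∈ H10 Ω,
    (∫ x in Ω, inner ℝ (Φ.grad x) (v.grad x)) + ∫ x in Ω, inner ℝ (W x) (Φ.grad x) * v.fn x =
      ∫ x in Ω, f x * v.fn x

end Landis

end

namespace Landis

/-! Write P = C'ε for the Poincaré bound and S for `gnsConst`. Smallness of ε‖W‖ makes P‖W‖ at most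
1/2, so the drift is absorbed by the Dirichlet energy: the form is coercive, Lax–Milgram gives
existence, and testing with Φ or with a difference of solutions gives the energy bound and
uniqueness.

The supremum bound is the real content, since the area of Ω is not controlled by ε. Stampacchia's
method alone gives Φ ≤ 8SP‖f‖|Ω|^(1/2), which is finite but has the wrong scaling. It is localised
by truncating Φ above a paraboloid a|x - x₀|² + k instead of a constant
(`exists_truncation_energy_le`). This adds the Laplacian 4a and a drift error L‖W‖ to the source,
where L bounds the slope of the paraboloid on the set where Φ exceeds it. The Sobolev inequality L¹
→ L² for gradients gives a quadratic decay of k ↦ ∫(Φ - a|x - x₀|² - k)₊, and Poincaré bounds its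
initial value (`ae_le_paraboloid_add`).

If Φ ≤ M, then with a = M/R² the truncation lives in the ball of radius R about x₀, so |Ω| is
replaced by R². Evaluating at x = x₀ bounds Φ by a constant times PR(‖f‖ + M/R² + (M/R)‖W‖)
(`ae_le_of_ae_le`). Taking M = ‖Φ‖_∞ and R a large multiple of P turns this into M ≤ const · P²‖f‖ +
M/2. The term M/2 can be absorbed because M is already known to be finite. -/

/-! ### Approximation and closedness in H₀¹. -/

theorem tendsto_eLpNorm_two_of_dominated {α E : Type*} [MeasurableSpace α] {μ : Measure α}
    [NormedAddCommGroup E] {b : ℕ → α → E} {h : α → ℝ}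
    (hb : ∀ n, AEStronglyMeasurable (b n) μ) (hh : MemLp h 2 μ)
    (hle : ∀ n, ∀ᵐ x ∂μ, ‖b n x‖ ≤ h x)
    (hlim : ∀ᵐ x ∂μ, Tendsto (fun n => b n x) atTop (𝓝 0)) :
    Tendsto (fun n => eLpNorm (b n) 2 μ) atTop (𝓝 0) := by
  have hfin : ∫⁻ x, ‖h x‖ₑ ^ (2 : ℝ) ∂μ ≠ ⊤ := by
    have := lintegral_rpow_enorm_lt_top_of_eLpNorm_lt_top (p := 2) (by simp) (by simp) hh.2
    simpa using this.ne
  have key : Tendsto (fun n => ∫⁻ x, ‖b n x‖ₑ ^ (2 : ℝ) ∂μ) atTop (𝓝 (∫⁻ _, 0 ∂μ)) := by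
    refine tendsto_lintegral_of_dominated_convergence' (fun x => ‖h x‖ₑ ^ (2 : ℝ))
      (fun n => (hb n).enorm.pow_const _) (fun n => ?_) hfin ?_
    · filter_upwards [hle n] with x hx
      gcongr
      exact enorm_le_iff_norm_le.2 (hx.trans (le_abs_self _))
    · filter_upwards [hlim] with x hx
      have h1 : Tendsto (fun n => ‖b n x‖ₑ) atTop (𝓝 0) := by simpa using hx.enorm
      simpa using h1.ennrpow_const (2 : ℝ)
  rw [lintegral_zero] at key
  have h2 : ∀ n, eLpNorm (b n) 2 μ = (∫⁻ x, ‖b n x‖ₑ ^ (2 : ℝ) ∂μ) ^ (1 / 2 : ℝ) := fun n => by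
    rw [eLpNorm_eq_lintegral_rpow_enorm_toReal (by simp) (by simp)]
    simp
  simp only [h2]
  simpa using key.ennrpow_const (1 / 2 : ℝ)

/-- Closedness of `H10` for limits given by explicit functions; this is how the pointwise formulas
for truncations become members of the space. -/
theorem exists_mem_H10_of_tendsto {Ω : Set Plane} {r : ℕ → L2Pair Ω} (hr : ∀ n, r n ∈ H10 Ω)
    {a : Plane → ℝ} {b : Plane → Plane} (ha : MemLp a 2 (vol Ω)) (hb : MemLp b 2 (vol Ω))
    (h1 : Tendsto (fun n => eLpNorm (⇑(r n).fn - a) 2 (vol Ω)) atTop (𝓝 0))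
    (h2 : Tendsto (fun n => eLpNorm (⇑(r n).grad - b) 2 (vol Ω)) atTop (𝓝 0)) :
    ∃ p ∈ H10 Ω, p.fn =ᵐ[vol Ω] a ∧ p.grad =ᵐ[vol Ω] b := by
  refine ⟨WithLp.toLp 2 (ha.toLp a, hb.toLp b), ?_, ha.coeFn_toLp, hb.coeFn_toLp⟩
  have l1 : Tendsto (fun n => (r n).fn) atTop (𝓝 (ha.toLp a)) := by
    rw [Lp.tendsto_Lp_iff_tendsto_eLpNorm']
    refine h1.congr fun n => eLpNorm_congr_ae ?_
    filter_upwards [ha.coeFn_toLp] with x hx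
    simp [hx]
  have l2 : Tendsto (fun n => (r n).grad) atTop (𝓝 (hb.toLp b)) := by
    rw [Lp.tendsto_Lp_iff_tendsto_eLpNorm']
    refine h2.congr fun n => eLpNorm_congr_ae ?_
    filter_upwards [hb.coeFn_toLp] with x hx
    simp [hx]
  have hc := (WithLp.prod_continuous_toLp 2 (Lp ℝ 2 (vol Ω)) (Lp Plane 2 (vol Ω))).tendsto
    (ha.toLp a, hb.toLp b)
  refine (Submodule.isClosed_topologicalClosure (testPairs Ω)).mem_of_tendsto
    (hc.comp (l1.prodMk_nhds l2)) (Eventually.of_forall fun n => ?_)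
  exact hr n

theorem exists_seq_testPairs {Ω : Set Plane} {p : L2Pair Ω} (hp : p ∈ H10 Ω) :
    ∃ r : ℕ → L2Pair Ω, (∀ n, r n ∈ testPairs Ω) ∧
      Tendsto (fun n => (r n).fn) atTop (𝓝 p.fn) ∧
      Tendsto (fun n => (r n).grad) atTop (𝓝 p.grad) ∧
      ∀ᵐ x ∂vol Ω, Tendsto (fun n => (r n).fn x) atTop (𝓝 (p.fn x)) := by
  obtain ⟨r, hr, hlim⟩ := mem_closure_iff_seq_limit.1
    (show p ∈ closure (testPairs Ω : Set (L2Pair Ω)) from hp)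
  have h := ((WithLp.prod_continuous_ofLp 2 (Lp ℝ 2 (vol Ω)) (Lp Plane 2 (vol Ω))).tendsto p).comp
    hlim
  have h1 : Tendsto (fun n => (r n).fn) atTop (𝓝 p.fn) := (continuous_fst.tendsto _).comp h
  have h2 : Tendsto (fun n => (r n).grad) atTop (𝓝 p.grad) := (continuous_snd.tendsto _).comp h
  obtain ⟨s, hs, hae⟩ := (tendstoInMeasure_of_tendsto_Lp h1).exists_seq_tendsto_ae
  exact ⟨r ∘ s, fun n => hr _, h1.comp hs.tendsto_atTop, h2.comp hs.tendsto_atTop, hae⟩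

theorem IsTest.memLp_gradient {Ω : Set Plane} {φ : Plane → ℝ} (hφ : IsTest Ω φ) :
    MemLp (gradient φ) 2 (vol Ω) := by
  have hc : Continuous (gradient φ) :=
    (InnerProductSpace.toDual ℝ Plane).symm.continuous.comp
      (hφ.contDiff.continuous_fderiv (by simp))
  refine (hc.memLp_of_hasCompactSupport ?_).restrict Ω
  exact (hφ.compact.fderiv (𝕜 := ℝ)).comp_left (g := (InnerProductSpace.toDual ℝ Plane).symm)
    (map_zero _)

theorem IsTest.exists_mem_testPairs {Ω : Set Plane} {φ : Plane → ℝ} (hφ : IsTest Ω φ) :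
    ∃ p ∈ testPairs Ω, p.fn =ᵐ[vol Ω] φ ∧ p.grad =ᵐ[vol Ω] gradient φ :=
  ⟨WithLp.toLp 2 (hφ.memLp.toLp φ, hφ.memLp_gradient.toLp _),
    ⟨φ, hφ, hφ.memLp.coeFn_toLp, hφ.memLp_gradient.coeFn_toLp⟩,
    hφ.memLp.coeFn_toLp, hφ.memLp_gradient.coeFn_toLp⟩

/-! ### Chain rule and truncation in H₀¹. -/

/-- If `β` vanishes on `(-∞, 0]` and `q ≥ 0`, then `β (φ - q)` is supported where `φ` is. -/
theorem IsTest.comp_sub {Ω : Set Plane} {φ q : Plane → ℝ} {β : ℝ → ℝ} (hφ : IsTest Ω φ)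
    (hq : ContDiff ℝ ∞ q) (hq0 : ∀ x, 0 ≤ q x) (hβ : ContDiff ℝ ∞ β) (hβ0 : ∀ t ≤ 0, β t = 0) :
    IsTest Ω (fun x => β (φ x - q x)) := by
  have hsub : Function.support (fun x => β (φ x - q x)) ⊆ Function.support φ := by
    intro x hx hx0
    refine hx (hβ0 _ ?_)
    rw [show φ x = 0 from hx0]
    simpa using hq0 x
  exact ⟨hβ.comp (hφ.contDiff.sub hq), hφ.compact.mono hsub,
    (closure_mono hsub).trans hφ.subset⟩

/-- For test functions φₙ → p the composites β(φₙ - q) are again test functions. The functions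
converge because β is Lipschitz. The gradient error splits into β'(φₙ - q)(∇φₙ - ∇p), controlled by
L, and (β'(φₙ - q) - β'(p - q))(∇p - g), which vanishes by dominated convergence along an a.e.
convergent sequence. -/
theorem exists_mem_H10_comp_sub {Ω : Set Plane} {p : L2Pair Ω} (hp : p ∈ H10 Ω)
    {q : Plane → ℝ} {g : Plane → Plane} (hq : ContDiff ℝ ∞ q) (hq0 : ∀ x, 0 ≤ q x)
    (hg : ∀ x, HasGradientAt q (g x) x) (hgL : MemLp g 2 (vol Ω))
    {β : ℝ → ℝ} (hβ : ContDiff ℝ ∞ β) (hβ0 : ∀ t ≤ 0, β t = 0) {L : ℝ}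
    (hL : ∀ t, |deriv β t| ≤ L) :
    ∃ w ∈ H10 Ω, w.fn =ᵐ[vol Ω] (fun x => β (p.fn x - q x)) ∧
      w.grad =ᵐ[vol Ω] fun x => deriv β (p.fn x - q x) • (p.grad x - g x) := by
  have hL0 : 0 ≤ L := (abs_nonneg _).trans (hL 0)
  have hlip : ∀ s t, |β s - β t| ≤ L * |s - t| := fun s t => by
    have := Convex.norm_image_sub_le_of_norm_deriv_le (f := β) (s := Set.univ) (C := L) (x := t)
      (y := s) (fun x _ => (hβ.differentiable (by simp)) x) (fun x _ => hL x) convex_univ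
      trivial trivial
    simpa using this
  have hdc : Continuous (deriv β) := hβ.continuous_deriv (by simp)
  have mp : AEStronglyMeasurable (fun x => p.fn x - q x) (vol Ω) :=
    (Lp.aestronglyMeasurable p.fn).sub hq.continuous.aestronglyMeasurable
  have hpg : MemLp (fun x => p.grad x - g x) 2 (vol Ω) := (Lp.memLp p.grad).sub hgL
  have mD : AEStronglyMeasurable (fun x => deriv β (p.fn x - q x)) (vol Ω) :=
    hdc.comp_aestronglyMeasurable mp
  have ha : MemLp (fun x => β (p.fn x - q x)) 2 (vol Ω) := by
    refine MemLp.of_le_mul (c := L) (Lp.memLp p.fn) (hβ.continuous.comp_aestronglyMeasurable mp)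
      (Eventually.of_forall fun x => ?_)
    rw [Real.norm_eq_abs, Real.norm_eq_abs]
    rcases le_total (p.fn x - q x) 0 with h | h
    · rw [hβ0 _ h]; simpa using mul_nonneg hL0 (abs_nonneg _)
    · have h1 := hlip (p.fn x - q x) 0
      rw [hβ0 0 le_rfl, sub_zero, sub_zero, abs_of_nonneg h] at h1
      refine h1.trans (mul_le_mul_of_nonneg_left ?_ hL0)
      have := le_abs_self (p.fn x)
      linarith [hq0 x]
  have hb : MemLp (fun x => deriv β (p.fn x - q x) • (p.grad x - g x)) 2 (vol Ω) := by
    refine MemLp.of_le_mul (c := L) hpg (mD.smul hpg.1) (Eventually.of_forall fun x => ?_)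
    rw [norm_smul]
    exact mul_le_mul_of_nonneg_right (hL _) (norm_nonneg _)
  obtain ⟨r, hr, l1, l2, lae⟩ := exists_seq_testPairs hp
  choose φ hφ hφ1 hφ2 using hr
  have ht : ∀ n, IsTest Ω (fun x => β (φ n x - q x)) := fun n => (hφ n).comp_sub hq hq0 hβ hβ0
  choose s hs hs1 hs2 using fun n => (ht n).exists_mem_testPairs
  have hgrad : ∀ n x, gradient (fun x => β (φ n x - q x)) x
      = deriv β (φ n x - q x) • (gradient (φ n) x - g x) := fun n x => by
    have h1 : HasFDerivAt (fun x => φ n x - q x) _ x :=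
      ((hφ n).differentiable x).hasFDerivAt.sub (hg x).hasFDerivAt
    have h2 := ((hβ.differentiable (by simp)) (φ n x - q x)).hasDerivAt.comp_hasFDerivAt x h1
    unfold gradient
    rw [show (fun x => β (φ n x - q x)) = β ∘ (fun x => φ n x - q x) from rfl, h2.fderiv]
    simp
  have l1' := (Lp.tendsto_Lp_iff_tendsto_eLpNorm' _ _).1 l1
  have l2' := (Lp.tendsto_Lp_iff_tendsto_eLpNorm' _ _).1 l2
  refine exists_mem_H10_of_tendsto (r := s) (fun n => Submodule.le_topologicalClosure _ (hs n))
    ha hb ?_ ?_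
  · have h0 : Tendsto (fun n => ENNReal.ofReal L * eLpNorm ((r n).fn - p.fn : Plane → ℝ) 2 (vol Ω))
        atTop (𝓝 0) := by
      simpa using ENNReal.Tendsto.const_mul l1' (Or.inr ENNReal.ofReal_ne_top)
    refine tendsto_of_tendsto_of_tendsto_of_le_of_le tendsto_const_nhds h0 (fun _ => zero_le)
      fun n => ?_
    refine eLpNorm_le_mul_eLpNorm_of_ae_le_mul ?_ 2
    filter_upwards [hs1 n, hφ1 n] with x h1 h2
    simp only [Pi.sub_apply, Real.norm_eq_abs]
    rw [h1, h2]
    convert hlip _ _ using 2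
    ring_nf
  · have hA : Tendsto (fun n => ENNReal.ofReal L *
        eLpNorm ((r n).grad - p.grad : Plane → Plane) 2 (vol Ω)) atTop (𝓝 0) := by
      simpa using ENNReal.Tendsto.const_mul l2' (Or.inr ENNReal.ofReal_ne_top)
    have mD' : ∀ n, AEStronglyMeasurable (fun x => deriv β ((r n).fn x - q x)) (vol Ω) := fun n =>
      hdc.comp_aestronglyMeasurable
        ((Lp.aestronglyMeasurable (r n).fn).sub hq.continuous.aestronglyMeasurable)
    have mB : ∀ n, AEStronglyMeasurable (fun x => (deriv β ((r n).fn x - q x)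
        - deriv β (p.fn x - q x)) • (p.grad x - g x)) (vol Ω) := fun n =>
      ((mD' n).sub mD).smul hpg.1
    have hB : Tendsto (fun n => eLpNorm (fun x => (deriv β ((r n).fn x - q x)
        - deriv β (p.fn x - q x)) • (p.grad x - g x)) 2 (vol Ω)) atTop (𝓝 0) := by
      refine tendsto_eLpNorm_two_of_dominated (h := fun x => (L + L) * ‖p.grad x - g x‖) mB
        (hpg.norm.const_mul _) (fun n => Eventually.of_forall fun x => ?_) ?_
      · rw [norm_smul]
        refine mul_le_mul_of_nonneg_right ?_ (norm_nonneg _)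
        exact (norm_sub_le _ _).trans (add_le_add (hL _) (hL _))
      · filter_upwards [lae] with x hx
        have h1 : Tendsto (fun n => deriv β ((r n).fn x - q x) - deriv β (p.fn x - q x)) atTop
            (𝓝 0) := by
          rw [← sub_self (deriv β (p.fn x - q x))]
          exact ((hdc.tendsto _).comp (hx.sub_const _)).sub_const _
        simpa using h1.smul_const (p.grad x - g x)
    have hAB := hA.add hB
    rw [add_zero] at hAB
    refine tendsto_of_tendsto_of_tendsto_of_le_of_le tendsto_const_nhds hAB (fun _ => zero_le)
      fun n => ?_
    have mA : AEStronglyMeasurable (fun x => deriv β ((r n).fn x - q x) •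
        ((r n).grad x - p.grad x)) (vol Ω) :=
      (mD' n).smul ((Lp.aestronglyMeasurable _).sub (Lp.aestronglyMeasurable _))
    have e : (⇑(s n).grad - fun x => deriv β (p.fn x - q x) • (p.grad x - g x)) =ᵐ[vol Ω]
        (fun x => deriv β ((r n).fn x - q x) • ((r n).grad x - p.grad x)) +
        fun x => (deriv β ((r n).fn x - q x) - deriv β (p.fn x - q x)) • (p.grad x - g x) := by
      filter_upwards [hs2 n, hφ1 n, hφ2 n] with x h1 h2 h3
      simp only [Pi.sub_apply, Pi.add_apply]
      rw [h1, hgrad, ← h2, ← h3]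
      module
    rw [eLpNorm_congr_ae e]
    refine (eLpNorm_add_le mA (mB n) (by norm_num)).trans (add_le_add ?_ le_rfl)
    refine eLpNorm_le_mul_eLpNorm_of_ae_le_mul (Eventually.of_forall fun x => ?_) 2
    rw [norm_smul]
    exact mul_le_mul_of_nonneg_right (hL _) (norm_nonneg _)

/-- A smooth approximation of the positive part, equal to `0` on `(-∞, 0]` and to `t` on
`[1, ∞)`. -/
noncomputable def smoothPos (t : ℝ) : ℝ := t * Real.smoothTransition t

theorem contDiff_smoothPos : ContDiff ℝ ∞ smoothPos :=
  contDiff_id.mul Real.smoothTransition.contDiff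

theorem smoothPos_of_nonpos {t : ℝ} (ht : t ≤ 0) : smoothPos t = 0 := by
  rw [smoothPos, Real.smoothTransition.zero_of_nonpos ht, mul_zero]

theorem continuous_deriv_smoothPos : Continuous (deriv smoothPos) :=
  contDiff_smoothPos.continuous_deriv (by simp)

theorem deriv_smoothPos_of_one_lt {t : ℝ} (ht : 1 < t) : deriv smoothPos t = 1 := by
  have h : smoothPos =ᶠ[𝓝 t] id := by
    filter_upwards [lt_mem_nhds ht] with s hs
    rw [smoothPos, Real.smoothTransition.one_of_one_le hs.le, mul_one, id]
  rw [h.deriv_eq, deriv_id]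

theorem deriv_smoothPos_of_nonpos {t : ℝ} (ht : t ≤ 0) : deriv smoothPos t = 0 := by
  -- The endpoint t = 0 is reached by continuity from t < 0; it matters for the gradient on the
  -- level set {p = q}.
  have hcl : IsClosed {s : ℝ | deriv smoothPos s = 0} :=
    isClosed_eq continuous_deriv_smoothPos continuous_const
  have hsub : Set.Iio (0 : ℝ) ⊆ {s : ℝ | deriv smoothPos s = 0} := by
    intro s hs
    have h : smoothPos =ᶠ[𝓝 s] fun _ => 0 := by
      filter_upwards [gt_mem_nhds (show s < 0 from hs)] with r hr
      exact smoothPos_of_nonpos hr.le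
    rw [Set.mem_ofPred_eq, h.deriv_eq, deriv_const]
  have := closure_minimal hsub hcl
  rw [closure_Iio] at this
  exact this ht

theorem exists_abs_deriv_smoothPos_le : ∃ L : ℝ, ∀ t, |deriv smoothPos t| ≤ L := by
  obtain ⟨L, hL⟩ := (isCompact_Icc (a := (0 : ℝ)) (b := 1)).exists_bound_of_continuousOn
    continuous_deriv_smoothPos.continuousOn
  refine ⟨max L 1, fun t => ?_⟩
  rcases le_or_gt t 0 with h | h
  · rw [deriv_smoothPos_of_nonpos h, abs_zero]; exact zero_le_one.trans (le_max_right _ _)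
  rcases le_or_gt t 1 with h' | h'
  · exact (hL t ⟨h.le, h'⟩).trans (le_max_left _ _)
  · rw [deriv_smoothPos_of_one_lt h', abs_one]; exact le_max_right _ _

/-- `(u - q)₊ ∈ H₀¹(Ω)` for `u ∈ H₀¹(Ω)` and smooth `q ≥ 0`, with the expected gradient. -/
theorem exists_mem_H10_posPart_sub {Ω : Set Plane} {p : L2Pair Ω} (hp : p ∈ H10 Ω)
    {q : Plane → ℝ} {g : Plane → Plane} (hq : ContDiff ℝ ∞ q) (hq0 : ∀ x, 0 ≤ q x)
    (hg : ∀ x, HasGradientAt q (g x) x) (hgL : MemLp g 2 (vol Ω)) :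
    ∃ w ∈ H10 Ω, w.fn =ᵐ[vol Ω] (fun x => max (p.fn x - q x) 0) ∧
      w.grad =ᵐ[vol Ω] {x | q x < p.fn x}.indicator fun x => p.grad x - g x := by
  obtain ⟨L, hL⟩ := exists_abs_deriv_smoothPos_le
  have hL0 : 0 ≤ L := (abs_nonneg _).trans (hL 0)
  -- Rescaling keeps the Lipschitz constant L while the transition layer shrinks to (0, 1/(n+1)).
  let β : ℕ → ℝ → ℝ := fun n t => ((n : ℝ) + 1)⁻¹ * smoothPos (((n : ℝ) + 1) * t)
  have hpos : ∀ n : ℕ, 0 < (n : ℝ) + 1 := fun n => by positivity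
  have hβ : ∀ n, ContDiff ℝ ∞ (β n) := fun n =>
    contDiff_const.mul (contDiff_smoothPos.comp (contDiff_const.mul contDiff_id))
  have hβ0 : ∀ n, ∀ t ≤ 0, β n t = 0 := fun n t ht => by
    simp only [β]
    rw [smoothPos_of_nonpos (mul_nonpos_of_nonneg_of_nonpos (hpos n).le ht), mul_zero]
  have hβ' : ∀ n t, deriv (β n) t = deriv smoothPos (((n : ℝ) + 1) * t) := fun n t => by
    have h1 : HasDerivAt (fun t : ℝ => ((n : ℝ) + 1) * t) ((n : ℝ) + 1) t := by
      simpa using (hasDerivAt_id t).const_mul ((n : ℝ) + 1)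
    have h2 := ((contDiff_smoothPos.differentiable (by simp)
      (((n : ℝ) + 1) * t)).hasDerivAt.comp t h1).const_mul ((n : ℝ) + 1)⁻¹
    rw [show β n = fun t => ((n : ℝ) + 1)⁻¹ * (smoothPos ∘ fun t => ((n : ℝ) + 1) * t) t from rfl,
      h2.deriv]
    field_simp [(hpos n).ne']
  have hβL : ∀ n t, |deriv (β n) t| ≤ L := fun n t => by rw [hβ']; exact hL _
  have hβeq : ∀ n t, β n t = t * Real.smoothTransition (((n : ℝ) + 1) * t) := fun n t => by
    simp only [β, smoothPos]
    field_simp [(hpos n).ne']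
  choose s hs hs1 hs2 using fun n =>
    exists_mem_H10_comp_sub hp hq hq0 hg hgL (hβ n) (hβ0 n) (hβL n)
  have mset : MeasurableSet {x | q x < p.fn x} :=
    measurableSet_lt hq.continuous.measurable (Lp.stronglyMeasurable p.fn).measurable
  have mp : AEStronglyMeasurable (fun x => p.fn x - q x) (vol Ω) :=
    (Lp.aestronglyMeasurable p.fn).sub hq.continuous.aestronglyMeasurable
  have hpg : MemLp (fun x => p.grad x - g x) 2 (vol Ω) := (Lp.memLp p.grad).sub hgL
  have hmax : ∀ x, |max (p.fn x - q x) 0| ≤ |p.fn x| := fun x => by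
    rw [abs_of_nonneg (le_max_right _ _)]
    refine max_le ?_ (abs_nonneg _)
    linarith [hq0 x, le_abs_self (p.fn x)]
  have ha : MemLp (fun x => max (p.fn x - q x) 0) 2 (vol Ω) :=
    (Lp.memLp p.fn).mono (mp.sup aestronglyMeasurable_const) (Eventually.of_forall hmax)
  have hb : MemLp ({x | q x < p.fn x}.indicator fun x => p.grad x - g x) 2 (vol Ω) :=
    hpg.indicator mset
  have hev : ∀ t : ℝ, 0 < t → ∀ᶠ n : ℕ in atTop, 1 < ((n : ℝ) + 1) * t := fun t ht => by
    have : Tendsto (fun n : ℕ => ((n : ℝ) + 1) * t) atTop atTop :=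
      (tendsto_atTop_add_const_right _ _ tendsto_natCast_atTop_atTop).atTop_mul_const ht
    exact this.eventually_gt_atTop 1
  refine exists_mem_H10_of_tendsto hs ha hb ?_ ?_
  · refine tendsto_eLpNorm_two_of_dominated (h := fun x => |p.fn x|)
      (fun n => (Lp.aestronglyMeasurable _).sub ha.1) (Lp.memLp p.fn).norm (fun n => ?_) ?_
    · filter_upwards [hs1 n] with x hx
      rw [Pi.sub_apply, hx, Real.norm_eq_abs]
      refine le_trans ?_ (hmax x)
      rcases le_total (p.fn x - q x) 0 with h | h
      · rw [hβ0 n _ h, max_eq_right h]; simp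
      · rw [hβeq, max_eq_left h, abs_of_nonneg h, abs_sub_le_iff]
        have h0 := Real.smoothTransition.nonneg (((n : ℝ) + 1) * (p.fn x - q x))
        have h1 := Real.smoothTransition.le_one (((n : ℝ) + 1) * (p.fn x - q x))
        constructor <;> nlinarith
    · filter_upwards [ae_all_iff.2 hs1] with x hx
      refine tendsto_const_nhds.congr' ?_
      simp only [Pi.sub_apply, hx]
      rcases le_or_gt (p.fn x - q x) 0 with h | h
      · refine Eventually.of_forall fun n => ?_
        beta_reduce
        rw [hβ0 n _ h, max_eq_right h, sub_zero]
      · filter_upwards [hev _ h] with n hn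
        rw [hβeq, max_eq_left h.le, Real.smoothTransition.one_of_one_le hn.le]
        ring
  · refine tendsto_eLpNorm_two_of_dominated (h := fun x => (L + 1) * ‖p.grad x - g x‖)
      (fun n => (Lp.aestronglyMeasurable _).sub hb.1) (hpg.norm.const_mul _) (fun n => ?_) ?_
    · filter_upwards [hs2 n] with x hx
      rw [Pi.sub_apply, hx, add_mul, one_mul]
      refine (norm_sub_le _ _).trans (add_le_add ?_ (norm_indicator_le_norm_self _ _))
      rw [norm_smul]
      exact mul_le_mul_of_nonneg_right (hβL n _) (norm_nonneg _)
    · filter_upwards [ae_all_iff.2 hs2] with x hx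
      refine tendsto_const_nhds.congr' ?_
      simp only [Pi.sub_apply, hx, hβ']
      -- Points with p = q fall in the first case, where every approximate derivative is 0. Hence
      -- nothing need be known about ∇p on level sets.
      rcases le_or_gt (p.fn x - q x) 0 with h | h
      · refine Eventually.of_forall fun n => ?_
        beta_reduce
        rw [deriv_smoothPos_of_nonpos (mul_nonpos_of_nonneg_of_nonpos (hpos n).le h),
          Set.indicator_of_notMem (by simpa using h)]
        simp
      · filter_upwards [hev _ h] with n hn
        rw [deriv_smoothPos_of_one_lt hn, Set.indicator_of_mem (by simpa using h)]
        simp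

/-! ### Sobolev inequality and functions living on small sets. -/

theorem eLpNorm_one_le_of_eq_zero_off {α E : Type*} [MeasurableSpace α] {μ : Measure α}
    [NormedAddCommGroup E] {f : α → E} (hf : AEStronglyMeasurable f μ) {A : Set α}
    (hA : MeasurableSet A) (h : ∀ᵐ x ∂μ, x ∉ A → f x = 0) :
    eLpNorm f 1 μ ≤ eLpNorm f 2 μ * μ A ^ (1 / 2 : ℝ) := by
  have e : f =ᵐ[μ] A.indicator f := by
    filter_upwards [h] with x hx
    by_cases hxA : x ∈ A
    · rw [Set.indicator_of_mem hxA]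
    · rw [Set.indicator_of_notMem hxA, hx hxA]
  rw [eLpNorm_congr_ae e, eLpNorm_indicator_eq_eLpNorm_restrict hA]
  refine (eLpNorm_le_eLpNorm_mul_rpow_measure_univ (p := 1) (q := 2) (by norm_num)
    hf.restrict).trans ?_
  rw [Measure.restrict_apply_univ]
  refine mul_le_mul' (eLpNorm_mono_measure f Measure.restrict_le_self) (le_of_eq ?_)
  norm_num

/-- A constant `S ≥ 1` in the inequality `‖u‖_{L²} ≤ S ‖∇u‖_{L¹}` of Gagliardo, Nirenberg and
Sobolev in the plane. -/
noncomputable def gnsConst : ℝ := eLpNormLESNormFDerivOneConst (volume : Measure Plane) 2 + 1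

theorem one_le_gnsConst : 1 ≤ gnsConst := le_add_of_nonneg_left (NNReal.coe_nonneg _)

theorem IsTest.eLpNorm_two_le {Ω : Set Plane} {φ : Plane → ℝ} (hφ : IsTest Ω φ) :
    eLpNorm φ 2 (vol Ω) ≤ ENNReal.ofReal gnsConst * eLpNorm (gradient φ) 1 (vol Ω) := by
  -- In dimension 2 the Sobolev exponent of L¹ is 2, which is its own Hölder conjugate.
  have hconj : NNReal.HolderConjugate (Module.finrank ℝ Plane : NNReal) 2 := by
    rw [finrank_euclideanSpace_fin]
    exact ⟨by push_cast; norm_num, by norm_num, by norm_num⟩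
  have h1 := eLpNorm_le_eLpNorm_fderiv_one (volume : Measure Plane)
    (hφ.contDiff.of_le (by simp)) hφ.compact hconj
  have h2 : eLpNorm (fderiv ℝ φ) 1 volume = eLpNorm (gradient φ) 1 (vol Ω) := by
    have e1 : eLpNorm (fderiv ℝ φ) 1 volume = eLpNorm (gradient φ) 1 volume := by
      refine eLpNorm_congr_norm_ae (Eventually.of_forall fun x => ?_)
      simp [gradient]
    rw [e1, eLpNorm_one_eq_lintegral_enorm, eLpNorm_one_eq_lintegral_enorm]
    refine (setLIntegral_eq_of_support_subset ?_).symm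
    intro x hx
    by_contra hxΩ
    refine hx ?_
    have : fderiv ℝ φ x = 0 := by
      by_contra h
      exact hxΩ (hφ.subset (support_fderiv_subset ℝ h))
    simp [gradient, this]
  rw [← h2]
  refine ((eLpNorm_mono_measure φ Measure.restrict_le_self).trans h1).trans ?_
  gcongr
  rw [gnsConst, ENNReal.ofReal_add (NNReal.coe_nonneg _) zero_le_one, ENNReal.ofReal_coe_nnreal]
  exact le_self_add

/-- By density of test functions: on a set of finite measure, L² convergence of the gradients
controls their L¹ norms. -/
theorem eLpNorm_fn_le_of_mem_H10 {Ω : Set Plane} (hΩ : volume Ω ≠ ⊤) {w : L2Pair Ω}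
    (hw : w ∈ H10 Ω) :
    eLpNorm w.fn 2 (vol Ω) ≤ ENNReal.ofReal gnsConst * eLpNorm w.grad 1 (vol Ω) := by
  obtain ⟨r, hr, l1, l2, -⟩ := exists_seq_testPairs hw
  have l2' := (Lp.tendsto_Lp_iff_tendsto_eLpNorm' _ _).1 l2
  have hΩ' : (vol Ω Set.univ) ^ (1 / 2 : ℝ) ≠ ⊤ := by
    rw [Measure.restrict_apply_univ]
    exact ENNReal.rpow_ne_top_of_nonneg (by norm_num) hΩ
  have hlim : Tendsto (fun n => ENNReal.ofReal gnsConst * (eLpNorm w.grad 1 (vol Ω) +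
      eLpNorm ((r n).grad - w.grad : Plane → Plane) 2 (vol Ω) * (vol Ω Set.univ) ^ (1 / 2 : ℝ)))
      atTop (𝓝 (ENNReal.ofReal gnsConst * (eLpNorm w.grad 1 (vol Ω) + 0 *
        (vol Ω Set.univ) ^ (1 / 2 : ℝ)))) :=
    ENNReal.Tendsto.const_mul (tendsto_const_nhds.add
      (ENNReal.Tendsto.mul_const l2' (Or.inr hΩ'))) (Or.inr ENNReal.ofReal_ne_top)
  rw [zero_mul, add_zero] at hlim
  have hlim1 : Tendsto (fun n => eLpNorm (r n).fn 2 (vol Ω)) atTop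
      (𝓝 (eLpNorm w.fn 2 (vol Ω))) := by
    simpa only [Lp.enorm_def] using l1.enorm
  refine le_of_tendsto_of_tendsto' hlim1 hlim fun n => ?_
  obtain ⟨φ, hφ, h1, h2⟩ := hr n
  refine (eLpNorm_congr_ae h1).trans_le (hφ.eLpNorm_two_le.trans ?_)
  rw [← eLpNorm_congr_ae h2]
  refine mul_le_mul_right ?_ _
  have m : AEStronglyMeasurable ((r n).grad - w.grad : Plane → Plane) (vol Ω) :=
    (Lp.aestronglyMeasurable _).sub (Lp.aestronglyMeasurable _)
  have e : (⇑(r n).grad : Plane → Plane) = ⇑w.grad + (⇑(r n).grad - ⇑w.grad) := by simp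
  calc eLpNorm (r n).grad 1 (vol Ω) = eLpNorm (⇑w.grad + (⇑(r n).grad - ⇑w.grad)) 1 (vol Ω) := by
        rw [← e]
    _ ≤ _ := eLpNorm_add_le (Lp.aestronglyMeasurable _) m le_rfl
    _ ≤ _ := by
      gcongr
      exact eLpNorm_one_le_of_eq_zero_off m MeasurableSet.univ (by simp)

theorem toReal_eLpNorm_one_le {α E : Type*} [MeasurableSpace α] {μ : Measure α}
    [IsFiniteMeasure μ] [NormedAddCommGroup E] (f : Lp E 2 μ) {A : Set α}
    (hA : MeasurableSet A) (h : ∀ᵐ x ∂μ, x ∉ A → f x = 0) :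
    (eLpNorm f 1 μ).toReal ≤ √(μ.real A) * ‖f‖ := by
  have h1 := eLpNorm_one_le_of_eq_zero_off (Lp.aestronglyMeasurable f) hA h
  have h2 := ENNReal.toReal_mono (ENNReal.mul_ne_top (Lp.eLpNorm_ne_top f)
    (ENNReal.rpow_ne_top_of_nonneg (by norm_num) (measure_ne_top μ A))) h1
  rwa [ENNReal.toReal_mul, ← ENNReal.toReal_rpow, ← Real.sqrt_eq_rpow, ← Lp.norm_def,
    mul_comm] at h2

/-- Sobolev followed by Cauchy–Schwarz on A. The factor √|A| is the gain that drives the Stampacchia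
iteration. -/
theorem norm_fn_le_of_grad_eq_zero_off {Ω : Set Plane} (hΩ : volume Ω ≠ ⊤) {w : L2Pair Ω}
    (hw : w ∈ H10 Ω) {A : Set Plane} (hA : MeasurableSet A)
    (h : ∀ᵐ x ∂vol Ω, x ∉ A → w.grad x = 0) :
    ‖w.fn‖ ≤ gnsConst * (√((vol Ω).real A) * ‖w.grad‖) := by
  have : IsFiniteMeasure (vol Ω) := ⟨by simpa using hΩ.lt_top⟩
  have hS : 0 ≤ gnsConst := zero_le_one.trans one_le_gnsConst
  have h0 := toReal_eLpNorm_one_le w.grad hA h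
  have hfin : eLpNorm w.grad 1 (vol Ω) ≠ ⊤ :=
    ((Lp.memLp w.grad).mono_exponent (by norm_num)).2.ne
  have h1 := ENNReal.toReal_mono (ENNReal.mul_ne_top ENNReal.ofReal_ne_top hfin)
    (eLpNorm_fn_le_of_mem_H10 hΩ hw)
  rw [ENNReal.toReal_mul, ENNReal.toReal_ofReal hS, ← Lp.norm_def] at h1
  exact h1.trans (mul_le_mul_of_nonneg_left h0 hS)

theorem integral_fn_le_of_eq_zero_off {α : Type*} [MeasurableSpace α] {μ : Measure α}
    [IsFiniteMeasure μ] (f : Lp ℝ 2 μ) {A : Set α}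
    (hA : MeasurableSet A) (h : ∀ᵐ x ∂μ, x ∉ A → f x = 0) :
    ∫ x, f x ∂μ ≤ √(μ.real A) * ‖f‖ := by
  refine le_trans ?_ (toReal_eLpNorm_one_le f hA h)
  rw [eLpNorm_one_eq_lintegral_enorm, ← integral_norm_eq_lintegral_enorm
    (Lp.aestronglyMeasurable f)]
  have hi : Integrable f μ := memLp_one_iff_integrable.1 ((Lp.memLp f).mono_exponent (by norm_num))
  exact integral_mono hi hi.norm fun x => le_abs_self _

/-! ### Integration by parts against the gradient of a paraboloid. -/

/-- Integration by parts against `x - x₀`, the gradient of `|x - x₀|² / 2`. -/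
theorem IsTest.integral_inner_sub_gradient {Ω : Set Plane} {φ : Plane → ℝ} (hφ : IsTest Ω φ)
    (x₀ : Plane) :
    ∫ x in Ω, inner ℝ (x - x₀) (gradient φ x) = -(2 * ∫ x in Ω, φ x) := by
  have dφ : ∀ e : Plane, Continuous fun x => fderiv ℝ φ x e := fun e =>
    (hφ.contDiff.continuous_fderiv (by simp)).clm_apply continuous_const
  have cφ := hφ.contDiff.continuous
  let b := EuclideanSpace.basisFun (Fin 2) ℝ
  have key : ∀ i, ∫ x, (x - x₀) i * fderiv ℝ φ x (b i) = -∫ x, φ x := fun i => by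
    have hl : ∀ x, HasFDerivAt (fun x : Plane => (x - x₀) i)
        (EuclideanSpace.proj i : Plane →L[ℝ] ℝ) x := fun x =>
      (EuclideanSpace.proj (𝕜 := ℝ) i).hasFDerivAt.comp x ((hasFDerivAt_id x).sub_const x₀)
    have cl : Continuous fun x : Plane => (x - x₀) i :=
      (EuclideanSpace.proj (𝕜 := ℝ) i).continuous.comp (continuous_id.sub continuous_const)
    have hd : ∀ x, fderiv ℝ (fun x : Plane => (x - x₀) i) x (b i) = 1 := fun x => by
      rw [(hl x).fderiv]; simp [b]
    have := integral_mul_fderiv_eq_neg_fderiv_mul_of_integrable (μ := (volume : Measure Plane))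
      (f := fun x : Plane => (x - x₀) i) (g := φ) (v := b i)
      (by simp only [hd, one_mul]; exact cφ.integrable_of_hasCompactSupport hφ.compact)
      ((cl.mul (dφ _)).integrable_of_hasCompactSupport
        (hφ.compact.fderiv_apply (𝕜 := ℝ) (b i)).mul_left)
      ((cl.mul cφ).integrable_of_hasCompactSupport hφ.compact.mul_left)
      (fun x _ => (hl x).differentiableAt) (fun x _ => hφ.differentiable x)
    simpa only [hd, one_mul] using this
  have e0 : ∀ x, inner ℝ (x - x₀) (gradient φ x) = ∑ i, (x - x₀) i * fderiv ℝ φ x (b i) :=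
    fun x => by
      rw [real_inner_comm, gradient, InnerProductSpace.toDual_symm_apply]
      conv_lhs => rw [← b.sum_repr (x - x₀)]
      simp [b]
  rw [setIntegral_eq_integral_of_forall_compl_eq_zero, setIntegral_eq_integral_of_forall_compl_eq_zero]
  · simp only [e0]
    rw [integral_finsetSum]
    · simp only [key, Fin.sum_univ_two]; ring
    · intro i _
      refine Continuous.integrable_of_hasCompactSupport (Continuous.mul ?_ (dφ _))
        (hφ.compact.fderiv_apply (𝕜 := ℝ) (b i)).mul_left
      exact (EuclideanSpace.proj (𝕜 := ℝ) i).continuous.comp (continuous_id.sub continuous_const)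
  · intro x hx
    exact image_eq_zero_of_notMem_tsupport fun h => hx (hφ.subset h)
  · intro x hx
    have : fderiv ℝ φ x = 0 := by
      by_contra h
      exact hx (hφ.subset (support_fderiv_subset ℝ h))
    simp [gradient, this]

theorem memLp_of_continuous_of_isBounded {E : Type*} [NormedAddCommGroup E] {Ω : Set Plane}
    (hΩ : Bornology.IsBounded Ω) (hm : MeasurableSet Ω) {g : Plane → E} (hg : Continuous g)
    (p : ℝ≥0∞) : MemLp g p (vol Ω) := by
  have : IsFiniteMeasure (vol Ω) := ⟨by simpa using hΩ.measure_lt_top⟩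
  obtain ⟨K, hK⟩ := (hΩ.isCompact_closure).exists_bound_of_continuousOn hg.continuousOn
  refine MemLp.of_bound hg.aestronglyMeasurable K ?_
  filter_upwards [ae_restrict_mem hm] with x hx
  exact hK x (subset_closure hx)

theorem integral_inner_sub_grad {Ω : Set Plane} (hΩ : Bornology.IsBounded Ω)
    (hm : MeasurableSet Ω) {w : L2Pair Ω} (hw : w ∈ H10 Ω) (x₀ : Plane) :
    ∫ x in Ω, inner ℝ (x - x₀) (w.grad x) = -(2 * ∫ x in Ω, w.fn x) := by
  have m1 : MemLp (fun x : Plane => x - x₀) 2 (vol Ω) :=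
    memLp_of_continuous_of_isBounded hΩ hm (by fun_prop) 2
  have m2 : MemLp (fun _ : Plane => (1 : ℝ)) 2 (vol Ω) :=
    memLp_of_continuous_of_isBounded hΩ hm continuous_const 2
  have a1 : ∀ p : L2Pair Ω, ∫ x in Ω, inner ℝ (x - x₀) (p.grad x) =
      inner ℝ (m1.toLp _) p.grad := fun p => by
    rw [L2.inner_def]
    refine integral_congr_ae ?_
    filter_upwards [m1.coeFn_toLp] with x hx
    rw [hx]
  have a2 : ∀ p : L2Pair Ω, ∫ x in Ω, p.fn x = inner ℝ (m2.toLp _) p.fn := fun p => by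
    rw [L2.inner_def]
    refine integral_congr_ae ?_
    filter_upwards [m2.coeFn_toLp] with x hx
    rw [hx]; simp
  obtain ⟨r, hr, l1, l2, -⟩ := exists_seq_testPairs hw
  rw [a1, a2]
  refine tendsto_nhds_unique (tendsto_const_nhds.inner l2)
    (((tendsto_const_nhds.inner l1).const_mul 2).neg.congr fun n => ?_)
  rw [← a2]
  obtain ⟨φ, hφ, h1, h2⟩ := hr n
  have e : ∫ x in Ω, inner ℝ (x - x₀) ((r n).grad x) =
      ∫ x in Ω, inner ℝ (x - x₀) (gradient φ x) := by
    refine integral_congr_ae ?_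
    filter_upwards [h2] with x hx
    rw [hx]
  rw [← a1, e, integral_congr_ae h1, hφ.integral_inner_sub_gradient]

/-! ### The drift term as a bounded operator on L². -/

theorem ae_norm_le_norm_of_Lp_top {α E : Type*} [MeasurableSpace α] {μ : Measure α}
    [NormedAddCommGroup E] (f : Lp E ⊤ μ) : ∀ᵐ x ∂μ, ‖f x‖ ≤ ‖f‖ := by
  filter_upwards [ae_le_eLpNormEssSup (f := f) (μ := μ)] with x hx
  rw [← eLpNorm_exponent_top, ← Lp.enorm_def] at hx
  exact enorm_le_iff_norm_le.1 hx

/-- The operator `G ↦ W · G` on `L²`. -/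
noncomputable def advection {Ω : Set Plane} (W : Lp Plane ⊤ (vol Ω)) :
    Lp Plane 2 (vol Ω) →L[ℝ] Lp ℝ 2 (vol Ω) :=
  (innerSL ℝ : Plane →L[ℝ] Plane →L[ℝ] ℝ).holderL (vol Ω) ⊤ 2 2 W

theorem coeFn_advection {Ω : Set Plane} (W : Lp Plane ⊤ (vol Ω)) (G : Lp Plane 2 (vol Ω)) :
    advection W G =ᵐ[vol Ω] fun x => inner ℝ (W x) (G x) :=
  (innerSL ℝ : Plane →L[ℝ] Plane →L[ℝ] ℝ).coeFn_holder W G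

theorem norm_advection_le {Ω : Set Plane} (W : Lp Plane ⊤ (vol Ω)) (G : Lp Plane 2 (vol Ω)) :
    ‖advection W G‖ ≤ ‖W‖ * ‖G‖ := by
  refine Lp.norm_le_mul_norm_of_ae_le_mul ?_
  filter_upwards [coeFn_advection W G, ae_norm_le_norm_of_Lp_top W] with x h1 h2
  rw [h1]
  exact (norm_inner_le_norm _ _).trans (mul_le_mul_of_nonneg_right h2 (norm_nonneg _))

theorem integral_advection_mul {Ω : Set Plane} (W : Lp Plane ⊤ (vol Ω)) (G : Lp Plane 2 (vol Ω))
    (u : Lp ℝ 2 (vol Ω)) :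
    ∫ x in Ω, inner ℝ (W x) (G x) * u x = inner ℝ (advection W G) u := by
  rw [L2.inner_def]
  refine integral_congr_ae ?_
  filter_upwards [coeFn_advection W G] with x hx
  rw [hx]; simp [mul_comm]

theorem integral_norm_mul_norm_le {α E F : Type*} [MeasurableSpace α] {μ : Measure α}
    [NormedAddCommGroup E] [NormedAddCommGroup F] (G : Lp E 2 μ) (u : Lp F 2 μ) :
    Integrable (fun x => ‖G x‖ * ‖u x‖) μ ∧ ∫ x, ‖G x‖ * ‖u x‖ ∂μ ≤ ‖G‖ * ‖u‖ := by
  have hG := (Lp.memLp G).norm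
  have hu := (Lp.memLp u).norm
  refine ⟨hG.integrable_mul hu, ?_⟩
  have e : ∫ x, ‖G x‖ * ‖u x‖ ∂μ = inner ℝ (hG.toLp _) (hu.toLp _) := by
    rw [L2.inner_def]
    refine integral_congr_ae ?_
    filter_upwards [hG.coeFn_toLp, hu.coeFn_toLp] with x h1 h2
    rw [h1, h2]; simp [mul_comm]
  rw [e]
  refine (real_inner_le_norm _ _).trans (le_of_eq ?_)
  rw [Lp.norm_toLp, Lp.norm_toLp, eLpNorm_norm, eLpNorm_norm, ← Lp.norm_def, ← Lp.norm_def]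

/-! ### Stampacchia iteration. -/

/-- Stampacchia's lemma with a quadratic gain. -/
theorem eq_zero_of_quadratic_gain {g : ℝ → ℝ} {K T : ℝ} (hg0 : ∀ k, 0 ≤ g k) (hg : Antitone g)
    (hK : 0 ≤ K) (h : ∀ k l, 0 ≤ k → k < l → g l * (l - k) ^ 2 ≤ K * g k ^ 2) (hT : 0 < T)
    (hKT : 16 * K * g 0 ≤ T ^ 2) : g T = 0 := by
  -- Levels T(1 - 2⁻ʲ): the gap to the next level is T·2⁻ʲ/2, and 16·K·g 0 ≤ T² is exactly what
  -- propagates the decay 4⁻ʲ.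
  have claim : ∀ j : ℕ, g (T * (1 - (1 / 2) ^ j)) ≤ g 0 * ((1 / 2) ^ j) ^ 2 := by
    intro j
    induction j with
    | zero => simp
    | succ j ih =>
      rw [pow_succ]
      have hx : (0 : ℝ) < (1 / 2) ^ j := by positivity
      have hx1 : ((1 : ℝ) / 2) ^ j ≤ 1 := pow_le_one₀ (by norm_num) (by norm_num)
      set x : ℝ := (1 / 2) ^ j
      have h1 := h (T * (1 - x)) (T * (1 - x * (1 / 2)))
        (mul_nonneg hT.le (by linarith)) (mul_lt_mul_of_pos_left (by linarith) hT)
      have h2 : g (T * (1 - x)) ^ 2 ≤ (g 0 * x ^ 2) ^ 2 := pow_le_pow_left₀ (hg0 _) ih 2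
      have h3 : K * g (T * (1 - x)) ^ 2 ≤ T ^ 2 / 16 * (g 0 * x ^ 4) := by
        refine (mul_le_mul_of_nonneg_left h2 hK).trans ?_
        have := mul_le_mul_of_nonneg_right hKT (mul_nonneg (hg0 0) (by positivity : 0 ≤ x ^ 4))
        linarith
      have h4 : g (T * (1 - x * (1 / 2))) * (T * x) ^ 2 ≤ g 0 * (x * (1 / 2)) ^ 2 * (T * x) ^ 2 := by
        linarith
      exact le_of_mul_le_mul_right h4 (by positivity)
  have hlim : Tendsto (fun j : ℕ => g 0 * ((1 / 2 : ℝ) ^ j) ^ 2) atTop (𝓝 0) := by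
    simpa using ((tendsto_pow_atTop_nhds_zero_of_lt_one (r := (1 / 2 : ℝ)) (by norm_num)
      (by norm_num)).pow 2).const_mul (g 0)
  refine le_antisymm (ge_of_tendsto' hlim fun j => (hg ?_).trans (claim j)) (hg0 T)
  have : (0 : ℝ) < (1 / 2) ^ j := by positivity
  nlinarith

theorem hasGradientAt_paraboloid (a k : ℝ) (x₀ x : Plane) :
    HasGradientAt (fun x : Plane => a * ‖x - x₀‖ ^ 2 + k) ((2 * a) • (x - x₀)) x := by
  have h : HasFDerivAt (fun x : Plane => a * ‖x - x₀‖ ^ 2 + k) _ x :=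
    ((((hasFDerivAt_id x).sub_const x₀).norm_sq).const_mul a).add_const k
  rw [hasGradientAt_iff_hasFDerivAt]
  refine h.congr_fderiv ?_
  ext v
  simp
  ring

/-! ### Truncation above a paraboloid. -/

section Energy

variable {Ω : Set Plane} {P : ℝ} {W : Lp Plane ⊤ (vol Ω)} {f : Lp ℝ ⊤ (vol Ω)} {Φ : L2Pair Ω}

/-- The energy inequality for the truncations of `Φ` above a paraboloid. -/
theorem exists_truncation_energy_le (hΩ : Bornology.IsBounded Ω) (hm : MeasurableSet Ω)
    (hP : ∀ w ∈ H10 Ω, ‖w.fn‖ ≤ P * ‖w.grad‖) (hPW : P * ‖W‖ ≤ 1 / 2)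
    (hΦ : IsWeakSolution Ω W f Φ) (x₀ : Plane) {a k L : ℝ} (ha : 0 ≤ a) (hk : 0 ≤ k)
    (hL : ∀ᵐ x ∂vol Ω, a * ‖x - x₀‖ ^ 2 + k < Φ.fn x → 2 * a * ‖x - x₀‖ ≤ L) :
    ∃ w ∈ H10 Ω, w.fn =ᵐ[vol Ω] (fun x => max (Φ.fn x - (a * ‖x - x₀‖ ^ 2 + k)) 0) ∧
      (∀ᵐ x ∂vol Ω, x ∉ {x | a * ‖x - x₀‖ ^ 2 + k < Φ.fn x} → w.grad x = 0) ∧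
      ‖w.grad‖ ^ 2 ≤ 2 * (‖f‖ + 4 * a + L * ‖W‖) * ∫ x in Ω, w.fn x := by
  have : IsFiniteMeasure (vol Ω) := ⟨by simpa using hΩ.measure_lt_top⟩
  obtain ⟨w, hw, hw1, hw2⟩ := exists_mem_H10_posPart_sub hΦ.1
    (q := fun x => a * ‖x - x₀‖ ^ 2 + k) (g := fun x => (2 * a) • (x - x₀))
    ((contDiff_const.mul ((contDiff_id.sub contDiff_const).norm_sq ℝ)).add contDiff_const)
    (fun x => by positivity) (hasGradientAt_paraboloid a k x₀)
    (memLp_of_continuous_of_isBounded hΩ hm (by fun_prop) 2)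
  have hoff : ∀ᵐ x ∂vol Ω, x ∉ {x | a * ‖x - x₀‖ ^ 2 + k < Φ.fn x} → w.grad x = 0 := by
    filter_upwards [hw2] with x hx hxA
    rw [hx, Set.indicator_of_notMem (by exact hxA)]
  refine ⟨w, hw, hw1, hoff, ?_⟩
  have iw : Integrable w.fn (vol Ω) :=
    memLp_one_iff_integrable.1 ((Lp.memLp w.fn).mono_exponent (by norm_num))
  have mx : MemLp (fun x : Plane => x - x₀) 2 (vol Ω) :=
    memLp_of_continuous_of_isBounded hΩ hm (by fun_prop) 2
  have ix : Integrable (fun x => inner ℝ (x - x₀) (w.grad x)) (vol Ω) := by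
    refine (L2.integrable_inner (𝕜 := ℝ) (mx.toLp _) w.grad).congr ?_
    filter_upwards [mx.coeFn_toLp] with x hx
    rw [hx]
  -- Where w lives, ∇Φ = ∇w + 2a(x - x₀), and ∫ (x - x₀)·∇w = -2∫w; the coefficient 4a is the
  -- Laplacian of a|x - x₀|².
  have e1 : ∫ x in Ω, inner ℝ (Φ.grad x) (w.grad x) = ‖w.grad‖ ^ 2 - 4 * a * ∫ x in Ω, w.fn x := by
    have h1 : ∫ x in Ω, inner ℝ (Φ.grad x) (w.grad x) =
        ∫ x in Ω, (inner ℝ (w.grad x) (w.grad x) + 2 * a * inner ℝ (x - x₀) (w.grad x)) := by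
      refine integral_congr_ae ?_
      filter_upwards [hw2] with x hx
      by_cases hxA : x ∈ {x | a * ‖x - x₀‖ ^ 2 + k < Φ.fn x}
      · rw [Set.indicator_of_mem hxA] at hx
        have : Φ.grad x = w.grad x + (2 * a) • (x - x₀) := by rw [hx]; simp
        rw [this, inner_add_left, real_inner_smul_left]
      · rw [Set.indicator_of_notMem hxA] at hx
        rw [hx]; simp
    rw [h1, integral_add (L2.integrable_inner w.grad w.grad) (ix.const_mul _),
      integral_const_mul, integral_inner_sub_grad hΩ hm hw, ← L2.inner_def,
      real_inner_self_eq_norm_sq]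
    ring
  obtain ⟨ic, hc⟩ := integral_norm_mul_norm_le w.grad w.fn
  -- On the same set |∇Φ| ≤ |∇w| + L; the first term will be absorbed by the energy and the second
  -- acts as a source.
  have e2 : -(‖W‖ * (‖w.grad‖ * ‖w.fn‖)) - L * ‖W‖ * ∫ x in Ω, w.fn x ≤
      ∫ x in Ω, inner ℝ (W x) (Φ.grad x) * w.fn x := by
    have h1 : ∫ x in Ω, (-(‖W‖ * (‖w.grad x‖ * ‖w.fn x‖)) - L * ‖W‖ * w.fn x) ≤
        ∫ x in Ω, inner ℝ (W x) (Φ.grad x) * w.fn x := by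
      refine integral_mono_ae ((ic.const_mul _).neg.sub (iw.const_mul _)) ?_ ?_
      · refine (L2.integrable_inner (𝕜 := ℝ) (advection W Φ.grad) w.fn).congr ?_
        filter_upwards [coeFn_advection W Φ.grad] with x hx
        rw [hx]; simp [mul_comm]
      · filter_upwards [hw1, hw2, hL, ae_norm_le_norm_of_Lp_top W] with x h1 h2 h3 h4
        by_cases hxA : x ∈ {x | a * ‖x - x₀‖ ^ 2 + k < Φ.fn x}
        · rw [Set.indicator_of_mem hxA] at h2
          have hg : ‖Φ.grad x‖ ≤ ‖w.grad x‖ + L := by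
            have e : Φ.grad x = w.grad x + (2 * a) • (x - x₀) := by rw [h2]; simp
            rw [e]
            refine (norm_add_le _ _).trans (add_le_add le_rfl ?_)
            rw [norm_smul, Real.norm_of_nonneg (by positivity)]
            exact h3 hxA
          have hw0 : 0 ≤ w.fn x := by rw [h1]; exact le_max_right _ _
          have hi := (abs_le.1 (abs_real_inner_le_norm (W x) (Φ.grad x))).1
          have hi' : ‖W x‖ * ‖Φ.grad x‖ ≤ ‖W‖ * (‖w.grad x‖ + L) :=
            mul_le_mul h4 hg (norm_nonneg _) (norm_nonneg _)
          rw [Real.norm_of_nonneg hw0]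
          have := mul_le_mul_of_nonneg_right ((neg_le_neg hi').trans hi) hw0
          linarith
        · have hw0 : w.fn x = 0 := by
            rw [h1]
            exact max_eq_right (by simpa using hxA)
          simp [hw0]
    have ic' : Integrable (fun x => -(‖W‖ * (‖w.grad x‖ * ‖w.fn x‖))) (vol Ω) :=
      (ic.const_mul _).neg
    rw [integral_sub ic' (iw.const_mul _), integral_neg, integral_const_mul,
      integral_const_mul] at h1
    have := mul_le_mul_of_nonneg_left hc (norm_nonneg W)
    linarith
  have e3 : ∫ x in Ω, f x * w.fn x ≤ ‖f‖ * ∫ x in Ω, w.fn x := by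
    rw [← integral_const_mul]
    refine integral_mono_ae ?_ (iw.const_mul _) ?_
    · refine (iw.norm.const_mul ‖f‖).mono' ((Lp.aestronglyMeasurable f).mul iw.1) ?_
      filter_upwards [ae_norm_le_norm_of_Lp_top f] with x hx
      rw [norm_mul]
      exact mul_le_mul_of_nonneg_right hx (norm_nonneg _)
    · filter_upwards [ae_norm_le_norm_of_Lp_top f, hw1] with x hx h1
      refine mul_le_mul_of_nonneg_right ((le_abs_self _).trans hx) ?_
      rw [h1]
      exact le_max_right _ _
  have e := hΦ.2 w hw
  -- Poincaré and P‖W‖ ≤ 1/2 bound ‖W‖‖∇w‖‖w‖ by half of ‖∇w‖², whence the factor 2 in the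
  -- conclusion.
  have h5 := mul_le_mul_of_nonneg_right (hP w hw) (mul_nonneg (norm_nonneg W) (norm_nonneg w.grad))
  have h6 := mul_le_mul_of_nonneg_right hPW (sq_nonneg ‖w.grad‖)
  linarith

/-- Here n, l, I stand for the L² norms of ∇w and w and for ∫w. Chaining gives I ≤ s·c·n, so the
energy inequality yields n ≤ 2F·s·c, and this is fed back. It serves with c from Sobolev (decay in
k) and with c = P (value at k = 0). -/
theorem le_of_gain {n l s c F I : ℝ} (hn : 0 ≤ n) (hs : 0 ≤ s) (hc : 0 ≤ c) (hF : 0 ≤ F)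
    (h1 : I ≤ s * l) (h2 : l ≤ c * n) (h3 : n ^ 2 ≤ 2 * F * I) : I ≤ 2 * F * (s * c) ^ 2 := by
  have h4 : I ≤ s * c * n := by
    rw [mul_assoc]; exact h1.trans (mul_le_mul_of_nonneg_left h2 hs)
  have hn' : n ≤ 2 * F * (s * c) := by
    rcases hn.eq_or_lt with h | h
    · rw [← h]; positivity
    · have : n * n ≤ 2 * F * (s * c) * n := by
        have := mul_le_mul_of_nonneg_left h4 (by positivity : 0 ≤ 2 * F)
        nlinarith
      exact le_of_mul_le_mul_right this h
  have := mul_le_mul_of_nonneg_left hn' (by positivity : 0 ≤ s * c)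
  linarith

/-- The supremum bound of Stampacchia, in terms of the Poincaré constant and of the measure of the
set where `Φ` is above a paraboloid. -/
theorem ae_le_paraboloid_add (hΩ : Bornology.IsBounded Ω) (hm : MeasurableSet Ω) (hP0 : 0 ≤ P)
    (hP : ∀ w ∈ H10 Ω, ‖w.fn‖ ≤ P * ‖w.grad‖) (hPW : P * ‖W‖ ≤ 1 / 2)
    (hΦ : IsWeakSolution Ω W f Φ) (x₀ : Plane) {a L m : ℝ} (ha : 0 ≤ a) (hL0 : 0 ≤ L)
    (hL : ∀ᵐ x ∂vol Ω, a * ‖x - x₀‖ ^ 2 < Φ.fn x → 2 * a * ‖x - x₀‖ ≤ L)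
    (hmA : (vol Ω).real {x | a * ‖x - x₀‖ ^ 2 < Φ.fn x} ≤ m) :
    ∀ᵐ x ∂vol Ω, Φ.fn x ≤ a * ‖x - x₀‖ ^ 2 +
      8 * gnsConst * P * (‖f‖ + 4 * a + L * ‖W‖) * √m := by
  have : IsFiniteMeasure (vol Ω) := ⟨by simpa using hΩ.measure_lt_top⟩
  have hS : 0 ≤ gnsConst := zero_le_one.trans one_le_gnsConst
  have hm0 : 0 ≤ m := measureReal_nonneg.trans hmA
  set F := ‖f‖ + 4 * a + L * ‖W‖ with hFdef
  have hF : 0 ≤ F := by positivity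
  set T₀ := 8 * gnsConst * P * F * √m with hT₀
  have hT₀0 : 0 ≤ T₀ := by positivity
  let A : ℝ → Set Plane := fun k => {x | a * ‖x - x₀‖ ^ 2 + k < Φ.fn x}
  have hA : ∀ k, MeasurableSet (A k) := fun k => measurableSet_lt
    (by fun_prop) (Lp.stronglyMeasurable Φ.fn).measurable
  let v : ℝ → Plane → ℝ := fun k x => max (Φ.fn x - (a * ‖x - x₀‖ ^ 2 + k)) 0
  let g : ℝ → ℝ := fun k => ∫ x in Ω, v k x
  have mq : MemLp (fun x : Plane => a * ‖x - x₀‖ ^ 2) 2 (vol Ω) :=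
    memLp_of_continuous_of_isBounded hΩ hm (by fun_prop) 2
  have iv : ∀ k, Integrable (v k) (vol Ω) := fun k =>
    (memLp_one_iff_integrable.1 (((Lp.memLp Φ.fn).sub
      (mq.add (memLp_const k))).mono_exponent (by norm_num))).pos_part
  have hv0 : ∀ k x, 0 ≤ v k x := fun k x => le_max_right _ _
  have hg0 : ∀ k, 0 ≤ g k := fun k => integral_nonneg (hv0 k)
  have hganti : Antitone g := fun k l hkl => integral_mono (iv l) (iv k) fun x =>
    max_le_max (by linarith) le_rfl
  have main : ∀ k, 0 ≤ k → g k ≤ 2 * F * (√((vol Ω).real (A k)) *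
      (gnsConst * √((vol Ω).real (A k)))) ^ 2 ∧
      g k ≤ 2 * F * (√((vol Ω).real (A k)) * P) ^ 2 := fun k hk => by
    obtain ⟨w, hw, hw1, hw2, hw3⟩ := exists_truncation_energy_le hΩ hm hP hPW hΦ x₀ ha hk
      (L := L) (hL.mono fun x hx hxk => hx (by linarith))
    have hI : ∫ x in Ω, w.fn x = g k := integral_congr_ae hw1
    have h1 := integral_fn_le_of_eq_zero_off w.fn (hA k) (by
      filter_upwards [hw1] with x hx hxA
      rw [hx]
      exact max_eq_right (by simpa [A] using hxA))
    have h2 := norm_fn_le_of_grad_eq_zero_off hΩ.measure_lt_top.ne hw (hA k) hw2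
    rw [hI] at h1 hw3
    rw [← mul_assoc] at h2
    exact ⟨le_of_gain (norm_nonneg _) (by positivity) (by positivity) hF h1 h2 hw3,
      le_of_gain (norm_nonneg _) (by positivity) hP0 hF h1 (hP w hw) hw3⟩
  -- T₀ may be 0 while the iteration needs a positive level, so every T > T₀ is treated and T is
  -- sent to T₀ at the end.
  have hT : ∀ T, T₀ < T → ∀ᵐ x ∂vol Ω, Φ.fn x ≤ a * ‖x - x₀‖ ^ 2 + T := fun T hTT => by
    have hTpos : 0 < T := hT₀0.trans_lt hTT
    have gT : g T = 0 := by
      refine eq_zero_of_quadratic_gain (K := 2 * F * gnsConst ^ 2) hg0 hganti (by positivity)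
        (fun k l hk hkl => ?_) hTpos ?_
      · have h1 := (main l (hk.trans hkl.le)).1
        -- Markov's inequality: the measure of the higher superlevel set is bounded by g at the
        -- lower level, which makes the gain quadratic.
        have h2 : (l - k) * (vol Ω).real (A l) ≤ g k := by
          refine le_trans ?_ (mul_meas_ge_le_integral_of_nonneg (Eventually.of_forall (hv0 k))
            (iv k) (l - k))
          refine mul_le_mul_of_nonneg_left (measureReal_mono fun x hx => ?_) (by linarith)
          have hx' : a * ‖x - x₀‖ ^ 2 + l < Φ.fn x := hx
          have hx'' : l - k ≤ Φ.fn x - (a * ‖x - x₀‖ ^ 2 + k) := by linarith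
          exact hx''.trans (le_max_left _ _)
        have h3 : ((l - k) * (vol Ω).real (A l)) ^ 2 ≤ g k ^ 2 :=
          pow_le_pow_left₀ (mul_nonneg (by linarith) measureReal_nonneg) h2 2
        have h4 : √((vol Ω).real (A l)) * (gnsConst * √((vol Ω).real (A l))) =
            gnsConst * (vol Ω).real (A l) := by
          rw [mul_left_comm, Real.mul_self_sqrt measureReal_nonneg]
        rw [h4] at h1
        calc g l * (l - k) ^ 2
            ≤ 2 * F * (gnsConst * (vol Ω).real (A l)) ^ 2 * (l - k) ^ 2 := by gcongr
          _ = 2 * F * gnsConst ^ 2 * ((l - k) * (vol Ω).real (A l)) ^ 2 := by ring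
          _ ≤ _ := by gcongr
      · have h1 := (main 0 le_rfl).2
        rw [mul_pow, Real.sq_sqrt measureReal_nonneg] at h1
        have hA0 : (vol Ω).real (A 0) ≤ m := by simpa [A] using hmA
        -- With g 0 ≤ 2F·m·P² the threshold 16·K·g 0 is at most 64·S²P²F²m = T₀², which is the
        -- origin of the 8 in T₀.
        calc 16 * (2 * F * gnsConst ^ 2) * g 0
            ≤ 16 * (2 * F * gnsConst ^ 2) * (2 * F * (m * P ^ 2)) := by
              gcongr
              exact h1.trans (by gcongr)
          _ = T₀ ^ 2 := by
            rw [hT₀, mul_pow, Real.sq_sqrt hm0]; ring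
          _ ≤ T ^ 2 := by gcongr
    have h0 := (integral_eq_zero_iff_of_nonneg (hv0 T) (iv T)).1 gT
    filter_upwards [h0] with x hx
    have : Φ.fn x - (a * ‖x - x₀‖ ^ 2 + T) ≤ 0 := (le_max_left _ _).trans_eq hx
    linarith
  have hn : ∀ᵐ x ∂vol Ω, ∀ n : ℕ, Φ.fn x ≤ a * ‖x - x₀‖ ^ 2 + (T₀ + 1 / ((n : ℝ) + 1)) :=
    ae_all_iff.2 fun n => hT _ (lt_add_of_pos_right _ (by positivity))
  filter_upwards [hn] with x hx
  have hlim : Tendsto (fun n : ℕ => a * ‖x - x₀‖ ^ 2 + (T₀ + 1 / ((n : ℝ) + 1))) atTop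
      (𝓝 (a * ‖x - x₀‖ ^ 2 + (T₀ + 0))) :=
    (tendsto_one_div_add_atTop_nhds_zero_nat.const_add _).const_add _
  rw [add_zero] at hlim
  exact ge_of_tendsto' hlim hx

end Energy

/-! ### Poincaré inequality, existence, uniqueness and energy bound. -/

/-- The constant is an infimum, so the inequality is first obtained with P + 1/(n+1) and then passed
to the limit. -/
theorem norm_fn_le_of_poincareConst_le {Ω : Set Plane} {P : ℝ} (hP0 : 0 ≤ P)
    (hP : poincareConst Ω ≤ ENNReal.ofReal P) {u : L2Pair Ω} (hu : u ∈ H10 Ω) :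
    ‖u.fn‖ ≤ P * ‖u.grad‖ := by
  have h : ∀ n : ℕ, ‖u.fn‖ ≤ (P + 1 / ((n : ℝ) + 1)) * ‖u.grad‖ := fun n => by
    have hδ : (0 : ℝ) < 1 / ((n : ℝ) + 1) := by positivity
    have hlt : poincareConst Ω < ENNReal.ofReal (P + 1 / ((n : ℝ) + 1)) :=
      hP.trans_lt ((ENNReal.ofReal_lt_ofReal_iff (by positivity)).2 (by linarith))
    obtain ⟨k, hk, hkP⟩ := sInf_lt_iff.1 hlt
    have h1 := (hk u hu).trans (mul_le_mul_left hkP.le _)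
    rw [← ofReal_norm, ← ofReal_norm, ← ENNReal.ofReal_mul (by positivity)] at h1
    exact (ENNReal.ofReal_le_ofReal_iff (by positivity)).1 h1
  have hlim : Tendsto (fun n : ℕ => (P + 1 / ((n : ℝ) + 1)) * ‖u.grad‖) atTop
      (𝓝 ((P + 0) * ‖u.grad‖)) :=
    (tendsto_one_div_add_atTop_nhds_zero_nat.const_add _).mul_const _
  rw [add_zero] at hlim
  exact ge_of_tendsto' hlim h

section Solution

variable {Ω : Set Plane} {P : ℝ} {W : Lp Plane ⊤ (vol Ω)} {Φ : L2Pair Ω}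

theorem isWeakSolution_iff {f : Lp ℝ ⊤ (vol Ω)} {F : Lp ℝ 2 (vol Ω)} (hF : F =ᵐ[vol Ω] f) :
    IsWeakSolution Ω W f Φ ↔ Φ ∈ H10 Ω ∧ ∀ v ∈ H10 Ω,
      inner ℝ Φ.grad v.grad + inner ℝ (advection W Φ.grad) v.fn = inner ℝ F v.fn := by
  refine and_congr_right fun _ => forall₂_congr fun v _ => ?_
  have e : ∫ x in Ω, f x * v.fn x = inner ℝ F v.fn := by
    rw [L2.inner_def]
    refine integral_congr_ae ?_
    filter_upwards [hF] with x hx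
    rw [hx]; simp [mul_comm]
  rw [integral_advection_mul, e, L2.inner_def Φ.grad v.grad]

theorem exists_Lp_two_eq [IsFiniteMeasure (vol Ω)] (f : Lp ℝ ⊤ (vol Ω)) :
    ∃ F : Lp ℝ 2 (vol Ω), F =ᵐ[vol Ω] f :=
  ⟨((Lp.memLp f).mono_exponent le_top).toLp f, MemLp.coeFn_toLp _⟩

theorem half_norm_grad_sq_le (hP : ∀ w ∈ H10 Ω, ‖w.fn‖ ≤ P * ‖w.grad‖)
    (hPW : P * ‖W‖ ≤ 1 / 2) (hΦ : Φ ∈ H10 Ω) :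
    1 / 2 * ‖Φ.grad‖ ^ 2 ≤ inner ℝ Φ.grad Φ.grad + inner ℝ (advection W Φ.grad) Φ.fn := by
  have h1 := (abs_le.1 (abs_real_inner_le_norm (advection W Φ.grad) Φ.fn)).1
  have h2 : ‖advection W Φ.grad‖ * ‖Φ.fn‖ ≤ ‖W‖ * ‖Φ.grad‖ * (P * ‖Φ.grad‖) :=
    mul_le_mul (norm_advection_le W _) (hP Φ hΦ) (norm_nonneg _) (by positivity)
  have h3 := mul_le_mul_of_nonneg_right hPW (sq_nonneg ‖Φ.grad‖)
  rw [real_inner_self_eq_norm_sq]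
  linarith

theorem norm_grad_le (hP0 : 0 ≤ P) (hP : ∀ w ∈ H10 Ω, ‖w.fn‖ ≤ P * ‖w.grad‖)
    (hPW : P * ‖W‖ ≤ 1 / 2) (hΦ : Φ ∈ H10 Ω) {F : Lp ℝ 2 (vol Ω)}
    (h : inner ℝ Φ.grad Φ.grad + inner ℝ (advection W Φ.grad) Φ.fn = inner ℝ F Φ.fn) :
    ‖Φ.grad‖ ≤ 2 * P * ‖F‖ := by
  have h1 := half_norm_grad_sq_le hP hPW hΦ
  rw [h] at h1
  have h2 := real_inner_le_norm F Φ.fn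
  have h3 := mul_le_mul_of_nonneg_left (hP Φ hΦ) (norm_nonneg F)
  rcases (norm_nonneg Φ.grad).eq_or_lt with h0 | h0
  · rw [← h0]; positivity
  · refine le_of_mul_le_mul_right ?_ h0
    linarith

/-- The difference solves the problem with source 0: the energy estimate kills its gradient, and
Poincaré then kills the function. -/
theorem eq_of_isWeakSolution (hP0 : 0 ≤ P) (hP : ∀ w ∈ H10 Ω, ‖w.fn‖ ≤ P * ‖w.grad‖)
    (hPW : P * ‖W‖ ≤ 1 / 2) [IsFiniteMeasure (vol Ω)] {f : Lp ℝ ⊤ (vol Ω)} {Ψ : L2Pair Ω}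
    (hΦ : IsWeakSolution Ω W f Φ) (hΨ : IsWeakSolution Ω W f Ψ) : Φ = Ψ := by
  obtain ⟨F, hF⟩ := exists_Lp_two_eq f
  rw [isWeakSolution_iff hF] at hΦ hΨ
  have hd : Φ - Ψ ∈ H10 Ω := Submodule.sub_mem _ hΦ.1 hΨ.1
  have e1 : (Φ - Ψ).grad = Φ.grad - Ψ.grad := rfl
  have hg : ‖(Φ - Ψ).grad‖ ≤ 2 * P * ‖(0 : Lp ℝ 2 (vol Ω))‖ := by
    refine norm_grad_le (W := W) hP0 hP hPW hd ?_
    have h1 := hΦ.2 _ hd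
    have h2 := hΨ.2 _ hd
    rw [inner_zero_left]
    nth_rewrite 1 [e1]
    nth_rewrite 2 [e1]
    rw [map_sub, inner_sub_left, inner_sub_left]
    linarith
  rw [norm_zero, mul_zero] at hg
  have hfn := hP _ hd
  have hg0 : ‖(Φ - Ψ).grad‖ = 0 := le_antisymm hg (norm_nonneg _)
  rw [hg0, mul_zero] at hfn
  have hn : ‖Φ - Ψ‖ ^ 2 = 0 := by
    rw [WithLp.prod_norm_sq_eq_of_L2, hg0, le_antisymm hfn (norm_nonneg _)]
    simp
  exact sub_eq_zero.1 (norm_eq_zero.1 (pow_eq_zero_iff (two_ne_zero) |>.1 hn))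

/-- Lax–Milgram on the Hilbert space `H10`. Its norm is the full H¹ norm, so Poincaré enters the
coercivity constant through 1 + P². -/
theorem exists_isWeakSolution (hP : ∀ w ∈ H10 Ω, ‖w.fn‖ ≤ P * ‖w.grad‖)
    (hPW : P * ‖W‖ ≤ 1 / 2) [IsFiniteMeasure (vol Ω)] (f : Lp ℝ ⊤ (vol Ω)) :
    ∃ Φ : L2Pair Ω, IsWeakSolution Ω W f Φ := by
  obtain ⟨F, hF⟩ := exists_Lp_two_eq f
  have : CompleteSpace (H10 Ω) :=
    (Submodule.isClosed_topologicalClosure (testPairs Ω)).completeSpace_coe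
  let fnL : H10 Ω →L[ℝ] Lp ℝ 2 (vol Ω) :=
    (WithLp.fstL 2 ℝ (Lp ℝ 2 (vol Ω)) (Lp Plane 2 (vol Ω))).comp (H10 Ω).subtypeL
  let gradL : H10 Ω →L[ℝ] Lp Plane 2 (vol Ω) :=
    (WithLp.sndL 2 ℝ (Lp ℝ 2 (vol Ω)) (Lp Plane 2 (vol Ω))).comp (H10 Ω).subtypeL
  let B : H10 Ω →L[ℝ] H10 Ω →L[ℝ] ℝ := (innerSL ℝ).bilinearComp gradL gradL +
    (innerSL ℝ).bilinearComp ((advection W).comp gradL) fnL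
  have hB : ∀ u v : H10 Ω, B u v = inner ℝ (u : L2Pair Ω).grad (v : L2Pair Ω).grad +
      inner ℝ (advection W (u : L2Pair Ω).grad) (v : L2Pair Ω).fn := fun u v => rfl
  have hcoer : IsCoercive B := by
    refine ⟨1 / (2 * (1 + P ^ 2)), by positivity, fun u => ?_⟩
    rw [hB]
    refine le_trans ?_ (half_norm_grad_sq_le hP hPW u.2)
    have h1 : ‖u‖ * ‖u‖ ≤ (1 + P ^ 2) * ‖(u : L2Pair Ω).grad‖ ^ 2 := by
      rw [← sq, Submodule.coe_norm, WithLp.prod_norm_sq_eq_of_L2]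
      have := pow_le_pow_left₀ (norm_nonneg _) (hP u u.2) 2
      rw [mul_pow] at this
      linarith
    rw [mul_assoc, div_mul_eq_mul_div, div_le_iff₀ (by positivity)]
    linarith
  let l : H10 Ω →L[ℝ] ℝ := (innerSL ℝ F).comp fnL
  let y := (InnerProductSpace.toDual ℝ (H10 Ω)).symm l
  let u := hcoer.continuousLinearEquivOfBilin.symm y
  refine ⟨u, (isWeakSolution_iff hF).2 ⟨u.2, fun v hv => ?_⟩⟩
  have h1 := hcoer.continuousLinearEquivOfBilin_apply u ⟨v, hv⟩
  rw [ContinuousLinearEquiv.apply_symm_apply, InnerProductSpace.toDual_symm_apply, hB] at h1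
  exact h1.symm

theorem IsWeakSolution.neg [IsFiniteMeasure (vol Ω)] {f : Lp ℝ ⊤ (vol Ω)}
    (hΦ : IsWeakSolution Ω W f Φ) :
    IsWeakSolution Ω W (-f : Lp ℝ ⊤ (vol Ω)) (-Φ) := by
  obtain ⟨F, hF⟩ := exists_Lp_two_eq f
  have hF' : (-F : Lp ℝ 2 (vol Ω)) =ᵐ[vol Ω] (-f : Lp ℝ ⊤ (vol Ω)) := by
    filter_upwards [hF, Lp.coeFn_neg F, Lp.coeFn_neg f] with x h1 h2 h3
    rw [h2, h3, Pi.neg_apply, Pi.neg_apply, h1]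
  rw [isWeakSolution_iff hF] at hΦ
  refine (isWeakSolution_iff hF').2 ⟨Submodule.neg_mem _ hΦ.1, fun v hv => ?_⟩
  have e : (-Φ).grad = -Φ.grad := rfl
  rw [e, map_neg, inner_neg_left, inner_neg_left, inner_neg_left, ← hΦ.2 v hv]
  ring

/-! ### Supremum bound independent of the size of Ω. -/

/-- An upper bound `M` for `Φ` improves itself: compare `Φ` with the paraboloids
`M |x - x₀|² / R²`, which are above `Φ` outside of a ball of radius `R`. -/
theorem ae_le_of_ae_le (hΩ : Bornology.IsBounded Ω) (hm : MeasurableSet Ω) (hP0 : 0 ≤ P)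
    (hP : ∀ w ∈ H10 Ω, ‖w.fn‖ ≤ P * ‖w.grad‖) (hPW : P * ‖W‖ ≤ 1 / 2) {f : Lp ℝ ⊤ (vol Ω)}
    (hΦ : IsWeakSolution Ω W f Φ) {M R : ℝ} (hM : 0 ≤ M) (hR : 0 < R)
    (hΦM : ∀ᵐ x ∂vol Ω, Φ.fn x ≤ M) :
    ∀ᵐ x ∂vol Ω, Φ.fn x ≤
      16 * gnsConst * P * R * (‖f‖ + 4 * (M / R ^ 2) + 2 * M / R * ‖W‖) := by
  set T := 16 * gnsConst * P * R * (‖f‖ + 4 * (M / R ^ 2) + 2 * M / R * ‖W‖) with hT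
  have hball : ∀ x₀ : Plane, ∀ᵐ x ∂vol Ω, M / R ^ 2 * ‖x - x₀‖ ^ 2 < Φ.fn x → ‖x - x₀‖ < R :=
    fun x₀ => by
      filter_upwards [hΦM] with x hx hlt
      by_contra! hge
      have h1 : R ^ 2 ≤ ‖x - x₀‖ ^ 2 := pow_le_pow_left₀ hR.le hge 2
      have h2 : M / R ^ 2 * R ^ 2 ≤ M / R ^ 2 * ‖x - x₀‖ ^ 2 := by gcongr
      rw [div_mul_cancel₀ _ (by positivity)] at h2
      linarith
  have hx₀ : ∀ x₀ : Plane, ∀ᵐ x ∂vol Ω, Φ.fn x ≤ M / R ^ 2 * ‖x - x₀‖ ^ 2 + T := fun x₀ => by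
    have h := ae_le_paraboloid_add hΩ hm hP0 hP hPW hΦ x₀ (a := M / R ^ 2) (L := 2 * M / R)
      (m := (2 * R) ^ 2) (by positivity) (by positivity) ?_ ?_
    · rw [Real.sqrt_sq (by positivity)] at h
      filter_upwards [h] with x hx
      refine hx.trans (le_of_eq ?_)
      rw [hT]; ring
    · filter_upwards [hball x₀] with x hx hlt
      calc 2 * (M / R ^ 2) * ‖x - x₀‖ ≤ 2 * (M / R ^ 2) * R := by
            gcongr
            exact (hx hlt).le
        _ = 2 * M / R := by field_simp
    -- The superlevel set lies, up to a null set, in a disc of area πR² ≤ (2R)², hence √m = 2R.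
    · have h1 : vol Ω {x | M / R ^ 2 * ‖x - x₀‖ ^ 2 < Φ.fn x} ≤ volume (Metric.ball x₀ R) := by
        refine (measure_mono_ae ?_).trans (Measure.restrict_le_self _)
        filter_upwards [hball x₀] with x hx hlt
        exact mem_ball_iff_norm.2 (hx hlt)
      have h2 := ENNReal.toReal_mono measure_ball_lt_top.ne h1
      refine h2.trans ?_
      rw [EuclideanSpace.volume_ball_fin_two, ENNReal.toReal_mul, ENNReal.toReal_pow,
        ENNReal.toReal_ofReal hR.le, ENNReal.toReal_ofReal Real.pi_pos.le]
      nlinarith [sq_nonneg R, Real.pi_le_four]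
  -- The exceptional null set depends on x₀. Countably many dense centres share one, and continuity
  -- in the centre then allows x₀ = x.
  have hd : ∀ᵐ x ∂vol Ω, ∀ n, Φ.fn x ≤ M / R ^ 2 * ‖x - TopologicalSpace.denseSeq Plane n‖ ^ 2 + T :=
    ae_all_iff.2 fun n => hx₀ _
  filter_upwards [hd] with x hx
  have hcl : IsClosed {y : Plane | Φ.fn x ≤ M / R ^ 2 * ‖x - y‖ ^ 2 + T} :=
    isClosed_le continuous_const (by fun_prop)
  have hsub : Set.range (TopologicalSpace.denseSeq Plane) ⊆
      {y : Plane | Φ.fn x ≤ M / R ^ 2 * ‖x - y‖ ^ 2 + T} := by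
    rintro _ ⟨n, rfl⟩
    exact hx n
  have hmem := closure_minimal hsub hcl (TopologicalSpace.denseRange_denseSeq Plane x)
  simpa using hmem

/-- The equation is linear, so -Φ solves it with source -f. One-sided bounds depending only on ‖f‖
and |Φ| are therefore two-sided. -/
theorem ae_abs_le_of_forall_isWeakSolution [IsFiniteMeasure (vol Ω)] {f : Lp ℝ ⊤ (vol Ω)}
    (hΦ : IsWeakSolution Ω W f Φ) {T : ℝ}
    (h : ∀ (f' : Lp ℝ ⊤ (vol Ω)) (Φ' : L2Pair Ω), IsWeakSolution Ω W f' Φ' → ‖f'‖ = ‖f‖ →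
      (∀ᵐ x ∂vol Ω, |Φ'.fn x| = |Φ.fn x|) → ∀ᵐ x ∂vol Ω, Φ'.fn x ≤ T) :
    ∀ᵐ x ∂vol Ω, |Φ.fn x| ≤ T := by
  have e : (-Φ).fn = -Φ.fn := rfl
  have h1 := h f Φ hΦ rfl (Eventually.of_forall fun _ => rfl)
  have h2 := h (-f) (-Φ) hΦ.neg (norm_neg f) (by
    filter_upwards [Lp.coeFn_neg Φ.fn] with x hx
    rw [e, hx, Pi.neg_apply, abs_neg])
  filter_upwards [h1, h2, Lp.coeFn_neg Φ.fn] with x h1 h2 h3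
  rw [e, h3, Pi.neg_apply] at h2
  exact abs_le.2 ⟨by linarith, h1⟩

theorem eLpNorm_top_le_of_isWeakSolution (hΩ : Bornology.IsBounded Ω) (hm : MeasurableSet Ω)
    (hP0 : 0 < P) (hP : ∀ w ∈ H10 Ω, ‖w.fn‖ ≤ P * ‖w.grad‖)
    (hPW : gnsConst * P * ‖W‖ ≤ 1 / 128) {f : Lp ℝ ⊤ (vol Ω)} (hΦ : IsWeakSolution Ω W f Φ) :
    eLpNorm Φ.fn ⊤ (vol Ω) ≤ ENNReal.ofReal (8192 * (gnsConst * P) ^ 2 * ‖f‖) := by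
  have : IsFiniteMeasure (vol Ω) := ⟨by simpa using hΩ.measure_lt_top⟩
  have hS : 0 < gnsConst := zero_lt_one.trans_le one_le_gnsConst
  have hPW' : P * ‖W‖ ≤ 1 / 2 := by
    have := mul_le_mul_of_nonneg_right one_le_gnsConst (by positivity : 0 ≤ P * ‖W‖)
    linarith
  -- A qualitative bound from the degenerate paraboloid a = 0; it depends on |Ω| and only serves to
  -- make M finite.
  have hbdd : ∃ B : ℝ, ∀ᵐ x ∂vol Ω, |Φ.fn x| ≤ B := by
    refine ⟨8 * gnsConst * P * ‖f‖ * √((vol Ω).real Set.univ),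
      ae_abs_le_of_forall_isWeakSolution hΦ fun f' Φ' hΦ' hf' _ => ?_⟩
    have h := ae_le_paraboloid_add hΩ hm hP0.le hP hPW' hΦ' 0 (a := 0) (L := 0)
      (m := (vol Ω).real Set.univ) le_rfl le_rfl (by simp) (measureReal_mono (Set.subset_univ _))
    simpa [hf'] using h
  obtain ⟨B, hB⟩ := hbdd
  have htop : eLpNorm Φ.fn ⊤ (vol Ω) ≠ ⊤ :=
    (memLp_top_of_bound (Lp.aestronglyMeasurable _) B hB).2.ne
  set M := (eLpNorm Φ.fn ⊤ (vol Ω)).toReal with hMdef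
  have hM0 : 0 ≤ M := ENNReal.toReal_nonneg
  have hM : ∀ᵐ x ∂vol Ω, |Φ.fn x| ≤ M := by
    filter_upwards [ae_le_eLpNormEssSup (f := Φ.fn) (μ := vol Ω)] with x hx
    rw [← eLpNorm_exponent_top] at hx
    have := ENNReal.toReal_mono htop hx
    rwa [toReal_enorm] at this
  set κ := 16 * gnsConst * P with hκ
  have hκ0 : 0 < κ := by positivity
  have hκW : κ * ‖W‖ ≤ 1 / 8 := by rw [hκ]; linarith
  have himp : ∀ᵐ x ∂vol Ω, |Φ.fn x| ≤ 16 * κ ^ 2 * ‖f‖ + M / 2 := by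
    refine ae_abs_le_of_forall_isWeakSolution hΦ fun f' Φ' hΦ' hf' habs => ?_
    have hM' : ∀ᵐ x ∂vol Ω, Φ'.fn x ≤ M := by
      filter_upwards [hM, habs] with x h1 h2
      exact (le_abs_self _).trans (h2.trans_le h1)
    -- With R = 16κ the paraboloid term is exactly M/4, and κ‖W‖ ≤ 1/8 makes the drift term at most
    -- M/4. After absorption 32κ² = 8192(SP)².
    have h := ae_le_of_ae_le hΩ hm hP0.le hP hPW' hΦ' hM0 (R := 16 * κ) (by positivity) hM'
    filter_upwards [h] with x hx
    refine hx.trans ?_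
    rw [← hκ, hf']
    have e : κ * (16 * κ) * (‖f‖ + 4 * (M / (16 * κ) ^ 2) + 2 * M / (16 * κ) * ‖W‖) =
        16 * κ ^ 2 * ‖f‖ + M / 4 + 2 * M * (κ * ‖W‖) := by
      field_simp
      ring
    rw [e]
    have := mul_le_mul_of_nonneg_left hκW (by positivity : 0 ≤ 2 * M)
    linarith
  have hle : eLpNorm Φ.fn ⊤ (vol Ω) ≤ ENNReal.ofReal (16 * κ ^ 2 * ‖f‖ + M / 2) := by
    rw [eLpNorm_exponent_top]
    exact eLpNormEssSup_le_of_ae_bound himp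
  have hMle : M ≤ 16 * κ ^ 2 * ‖f‖ + M / 2 := by
    have := ENNReal.toReal_mono ENNReal.ofReal_ne_top hle
    rwa [ENNReal.toReal_ofReal (by positivity)] at this
  rw [← ENNReal.ofReal_toReal htop]
  refine ENNReal.ofReal_le_ofReal ?_
  rw [← hMdef]
  calc M ≤ 32 * κ ^ 2 * ‖f‖ := by linarith
    _ = _ := by rw [hκ]; ring

theorem eLpNorm_grad_le_of_isWeakSolution [IsFiniteMeasure (vol Ω)] (hP0 : 0 ≤ P)
    (hP : ∀ w ∈ H10 Ω, ‖w.fn‖ ≤ P * ‖w.grad‖) (hPW : P * ‖W‖ ≤ 1 / 2) {f : Lp ℝ ⊤ (vol Ω)}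
    (hΦ : IsWeakSolution Ω W f Φ) :
    eLpNorm Φ.grad 2 (vol Ω) ≤ ENNReal.ofReal (2 * P) * eLpNorm f 2 (vol Ω) := by
  obtain ⟨F, hF⟩ := exists_Lp_two_eq f
  rw [isWeakSolution_iff hF] at hΦ
  have h := norm_grad_le hP0 hP hPW hΦ.1 (hΦ.2 Φ hΦ.1)
  rw [← eLpNorm_congr_ae hF, ← Lp.enorm_def, ← Lp.enorm_def, ← ofReal_norm, ← ofReal_norm,
    ← ENNReal.ofReal_mul (by positivity)]
  exact ENNReal.ofReal_le_ofReal h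

end Solution

end Landis

/-! ### The lemma, with explicit constants. -/

theorem mainTheorem6 (C' : ℝ) (hC' : 1 ≤ C') :
    ∃ c C : ℝ, 0 < c ∧ 0 < C ∧
      ∀ ε : ℝ, 0 < ε →
      ∀ Ω : Set Landis.Plane, IsOpen Ω → Bornology.IsBounded Ω →
        Landis.poincareConst Ω ≤ ENNReal.ofReal (C' * ε) →
      ∀ (W : Lp Landis.Plane ∞ (Landis.vol Ω)) (f : Lp ℝ ∞ (Landis.vol Ω)),
        ε + ε * ‖W‖ ≤ c →
        (∃! Φ : Landis.L2Pair Ω, Landis.IsWeakSolution Ω W f Φ) ∧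
        ∀ Φ : Landis.L2Pair Ω, Landis.IsWeakSolution Ω W f Φ →
          eLpNorm Φ.fn ∞ (Landis.vol Ω) ≤ ENNReal.ofReal (C * ε ^ 2 * ‖f‖) ∧
          eLpNorm Φ.grad 2 (Landis.vol Ω) ≤
            ENNReal.ofReal (C * ε) * eLpNorm f 2 (Landis.vol Ω) := by
  have hS := Landis.one_le_gnsConst
  set S := Landis.gnsConst
  have hS0 : 0 < S := zero_lt_one.trans_le hS
  have hC0 : 0 < C' := zero_lt_one.trans_le hC'
  -- The first constant gives S·P·‖W‖ ≤ 1/128 with P = C'ε, as the supremum bound requires; the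
  -- second is the constant of that bound.
  refine ⟨1 / (128 * (S * C')), 8192 * (S * C') ^ 2, by positivity, by positivity, ?_⟩
  intro ε hε Ω hΩo hΩ hPΩ W f hW
  have : IsFiniteMeasure (Landis.vol Ω) := ⟨by simpa using hΩ.measure_lt_top⟩
  have hP0 : 0 < C' * ε := by positivity
  have hP : ∀ w ∈ Landis.H10 Ω, ‖w.fn‖ ≤ C' * ε * ‖w.grad‖ := fun w hw =>
    Landis.norm_fn_le_of_poincareConst_le hP0.le hPΩ hw
  have hSW : S * (C' * ε) * ‖W‖ ≤ 1 / 128 := by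
    rw [le_div_iff₀ (by positivity)] at hW
    have : 0 < ε * (128 * (S * C')) := by positivity
    linarith
  have hPW : C' * ε * ‖W‖ ≤ 1 / 2 := by
    have := mul_le_mul_of_nonneg_right hS (by positivity : 0 ≤ C' * ε * ‖W‖)
    linarith
  have h1 : 1 ≤ S * C' := one_le_mul_of_one_le_of_one_le hS hC'
  obtain ⟨Φ₀, hΦ₀⟩ := Landis.exists_isWeakSolution hP hPW f
  refine ⟨⟨Φ₀, hΦ₀, fun Ψ hΨ => Landis.eq_of_isWeakSolution hP0.le hP hPW hΨ hΦ₀⟩,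
    fun Φ hΦ => ⟨?_, ?_⟩⟩
  · convert Landis.eLpNorm_top_le_of_isWeakSolution hΩ hΩo.measurableSet hP0 hP hSW hΦ using 2
    ring
  · refine (Landis.eLpNorm_grad_le_of_isWeakSolution hP0.le hP hPW hΦ).trans ?_
    gcongr ENNReal.ofReal ?_ * _
    -- The energy constant 2C' is dominated by the same C because S ≥ 1 and C' ≥ 1.
    have h2 : C' ≤ S * C' := le_mul_of_one_le_left hC0.le hS
    have h3 : S * C' ≤ (S * C') ^ 2 := le_self_pow₀ h1 two_ne_zero
    rw [← mul_assoc]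
    gcongr ?_ * _
    linarith
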